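/- **Setting.** Let $d\ge 3$, let $\sigma$ be the uniform probability measure on $\mathbb S^{d-1}$, let $f:[-1,1]\to[0,1]$ be measurable and $W(x,y)=f(\langle x,y\rangle)$. Let $T_Wg(x)=\int_{\mathbb S^{d-1}} g(y)W(x,y)\,d\sigma(y)$ on $L^2(\mathbb S^{d-1},\sigma)$, and let $\lambda(T_W)=(\lambda^*_k)_{k\ge 0}$ be its eigenvalues as a sequence tending to $0$, each nonzero one repeated according to its multiplicity, labelled so that $\lambda_0^*$ is the eigenvalue of the constants and $\lambda_1^*=\dots=\lambda_d^*$ that of the linear functions $x\mapsto\langle v,x\rangle$. Put $\Delta^*=\inf_{j\notin\{1,\dots,d\}}|\lambda_1^*-\lambda_j^*|$ and assume $\Delta^*>0$. For $n\in\mathbb N$, $0<\rho_n\le 1$ and latent points $X_1,\dots,X_n\in\mathbb S^{d-1}$ let $T_n=\frac1n(\rho_nW(X_i,X_j))_{i,j}$, and let $\hat T_n$ be the observed normalized adjacency matrix (symmetric, with $n\hat T_n$ having entries in $\{0,1\}$). For real sequences let $\delta_2(x,y)=\inf_p\big(\sum_i(x_i-y_{p(i)})^2\big)^{1/2}$, over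 the permutations $p$ of the non-negative integers; finite spectra are completed with zeros. Let $$\mathcal E=\Big\{\delta_2\big(\lambda(\tfrac1{\rho_n}T_n),\lambda(T_W)\big)\vee\frac{2^{9/2}\sqrt d}{\rho_n\Delta^*}\|T_n-\hat T_n\|_{op}\le\frac{\Delta^*}4\Big\}.$$ Let $\lambda_0\ge\dots\ge\lambda_{n-1}$ and $\hat\lambda_0\ge\dots\ge\hat\lambda_{n-1}$ be the eigenvalues of $T_n$ and $\hat T_n$. Sets of eigenvalues are taken with multiplicity, i.e. they are indexed by subsets of $\{0,\dots,n-1\}$. **Algorithm HEiC.** On input $(\hat T_n,d)$ it computes the $\hat\lambda_i$ and an orthonormal basis of corresponding eigenvectors. For a set $S$ of indices put $\mathrm{Gap}_1(\hat T_n;S)=\min_{i\notin S}\min_{j\in S}|\hat\lambda_j-\hat\lambda_i|$. Starting from the window $\{1,\dots,d\}$, it runs through the windows $\{i,\dots,i+d-1\}$, $i=2,\dots,n-d$, and keeps a new window (and its gap) whenever its $\mathrm{Gap}_1$ is strictly larger than that of the current one. It returns the final window and the matrix $(1/c_1)\hat V\hat V^T$, with $\hat V$ having as columns the eigenvectors with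 index in that window and $c_1=d/(d-2)$. **Proposition.** There is $n_0$, depending only on $d$ and $W$, such that for all $n$, $\rho_n$ and all realizations in $\mathcal E$ there is a set $\Lambda_1$ of $d$ eigenvalues of $\hat T_n$ with the following properties. 1. The diameter of $\Lambda_1$ is smaller than $\rho_n\Delta^*/2$, and its distance to the other eigenvalues of $\hat T_n$, as well as to $0$, is at least $\rho_n\Delta^*/2$. 2. The indices of $\Lambda_1$ are exactly those $i$ with $|\lambda_i/\rho_n-\lambda_1^*|\le\Delta^*/4$, and for these $|\hat\lambda_i/\rho_n-\lambda_i/\rho_n|\le\Delta^*/8$. 3. $\Lambda_1$ is the only set of $d$ eigenvalues of $\hat T_n$ at distance at least $\rho_n\Delta^*/2$ from the rest of the spectrum completed with zeros, i.e. from the other eigenvalues and from $0$. 4. If $n\ge n_0$, then $\Lambda_1$ is the only set of $d$ eigenvalues of $\hat T_n$ at distance at least $\rho_n\Delta^*/2$ from the other eigenvalues of $\hat T_n$ (in particular, the only one that also has diameter smaller than $\rho_n\Delta^*/2$). 5. If $n\ge n_0$, then HEiC selects $\Lambda_1$ and returns $\hat{\mathcal G}=(1/c_1)\hat V\hat V^T$,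 where the columns of $\hat V$ are any orthonormal eigenvectors of $\hat T_n$ corresponding to the eigenvalues in $\Lambda_1$. -/

import Mathlib

open MeasureTheory Filter Topology
open scoped ENNReal

noncomputable section

/-- The unit sphere of the Euclidean space `ℝ^d`. -/
abbrev Sph (d : ℕ) : Type := Metric.sphere (0 : EuclideanSpace ℝ (Fin d)) 1

/-- The uniform probability measure on the sphere: normalized surface measure. -/
def unifSphere (d : ℕ) : Measure (Sph d) :=
  ((volume : Measure (EuclideanSpace ℝ (Fin d))).toSphere Set.univ)⁻¹ •
    (volume : Measure (EuclideanSpace ℝ (Fin d))).toSphere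

instance instIsFiniteMeasureUnifSphere (d : ℕ) : IsFiniteMeasure (unifSphere d) := by
  constructor
  rw [unifSphere, Measure.smul_apply, smul_eq_mul]
  exact lt_of_le_of_lt (ENNReal.inv_mul_le_one _) ENNReal.one_lt_top

/-- The link function `f : [-1,1] → [0,1]` of a geometric graphon `W(x,y) = f(⟨x,y⟩)`
(extended to the real line in an arbitrary measurable way). -/
structure LinkFunction where
  toFun : ℝ → ℝ
  measurable_toFun : Measurable toFun
  nonneg : ∀ t ∈ Set.Icc (-1 : ℝ) 1, 0 ≤ toFun t
  le_one : ∀ t ∈ Set.Icc (-1 : ℝ) 1, toFun t ≤ 1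

/-- The geometric graphon `W(x,y) = f(⟨x,y⟩)` on the sphere. -/
def graphon {d : ℕ} (f : LinkFunction) (x y : Sph d) : ℝ :=
  f.toFun (inner ℝ (x : EuclideanSpace ℝ (Fin d)) (y : EuclideanSpace ℝ (Fin d)))

theorem inner_sph_mem {d : ℕ} (x y : Sph d) :
    inner ℝ (x : EuclideanSpace ℝ (Fin d)) (y : EuclideanSpace ℝ (Fin d))
      ∈ Set.Icc (-1 : ℝ) 1 := by
  have hx : ‖(x : EuclideanSpace ℝ (Fin d))‖ = 1 := by simp
  have hy : ‖(y : EuclideanSpace ℝ (Fin d))‖ = 1 := by simp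
  have h := abs_real_inner_le_norm (x : EuclideanSpace ℝ (Fin d))
    (y : EuclideanSpace ℝ (Fin d))
  rw [hx, hy, one_mul] at h
  exact abs_le.mp h

theorem graphon_nonneg {d : ℕ} (f : LinkFunction) (x y : Sph d) : 0 ≤ graphon f x y :=
  f.nonneg _ (inner_sph_mem x y)

theorem graphon_le_one {d : ℕ} (f : LinkFunction) (x y : Sph d) : graphon f x y ≤ 1 :=
  f.le_one _ (inner_sph_mem x y)

theorem measurable_graphon {d : ℕ} (f : LinkFunction) :
    Measurable (fun p : Sph d × Sph d => graphon f p.1 p.2) := by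
  unfold graphon
  have h := f.measurable_toFun
  exact h.comp (by fun_prop)

theorem integrable_graphon_mul {d : ℕ} (f : LinkFunction) (g : Lp ℝ 2 (unifSphere d))
    (x : Sph d) : Integrable (fun y => graphon f x y * g y) (unifSphere d) := by
  have hg : Integrable g (unifSphere d) := (Lp.memLp g).integrable (by norm_num)
  refine hg.bdd_mul (c := 1) ?_ ?_
  · exact ((measurable_graphon f).comp measurable_prodMk_left).aestronglyMeasurable
  · refine Eventually.of_forall fun y => ?_
    rw [Real.norm_eq_abs, abs_of_nonneg (graphon_nonneg f x y)]
    exact graphon_le_one f x y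

theorem memLp_graphon_integral {d : ℕ} (f : LinkFunction) (g : Lp ℝ 2 (unifSphere d)) :
    MemLp (fun x => ∫ y, graphon f x y * g y ∂(unifSphere d)) 2 (unifSphere d) := by
  refine MemLp.of_bound (C := ∫ y, ‖g y‖ ∂(unifSphere d)) ?_ ?_
  · have h : StronglyMeasurable (fun p : Sph d × Sph d => graphon f p.1 p.2 * g p.2) :=
      (measurable_graphon f).stronglyMeasurable.mul
        ((Lp.stronglyMeasurable g).comp_measurable measurable_snd)
    exact h.integral_prod_right.aestronglyMeasurable
  · refine Eventually.of_forall fun x => ?_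
    have hg : Integrable g (unifSphere d) := (Lp.memLp g).integrable (by norm_num)
    refine norm_integral_le_of_norm_le hg.norm (Eventually.of_forall fun y => ?_)
    rw [norm_mul, Real.norm_eq_abs, abs_of_nonneg (graphon_nonneg f x y)]
    exact mul_le_of_le_one_left (norm_nonneg _) (graphon_le_one f x y)

/-- The integral operator `(T_W g)(x) = ∫ g(y) W(x,y) dσ(y)` on `L²` of the sphere. -/
def graphonOp (d : ℕ) (f : LinkFunction) :
    Lp ℝ 2 (unifSphere d) →ₗ[ℝ] Lp ℝ 2 (unifSphere d) where
  toFun g := (memLp_graphon_integral f g).toLp _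
  map_add' g h := by
    rw [← MemLp.toLp_add, MemLp.toLp_eq_toLp_iff]
    refine Eventually.of_forall fun x => ?_
    simp only [Pi.add_apply]
    rw [← integral_add (integrable_graphon_mul f g x) (integrable_graphon_mul f h x)]
    refine integral_congr_ae ?_
    filter_upwards [Lp.coeFn_add g h] with y hy
    rw [hy, Pi.add_apply, mul_add]
  map_smul' c g := by
    rw [RingHom.id_apply, ← MemLp.toLp_const_smul, MemLp.toLp_eq_toLp_iff]
    refine Eventually.of_forall fun x => ?_
    simp only [Pi.smul_apply, smul_eq_mul]
    rw [← integral_const_mul]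
    refine integral_congr_ae ?_
    filter_upwards [Lp.coeFn_smul c g] with y hy
    rw [hy, Pi.smul_apply, smul_eq_mul]
    ring

theorem memLp_linear {d : ℕ} (v : EuclideanSpace ℝ (Fin d)) :
    MemLp (fun x : Sph d => inner ℝ v (x : EuclideanSpace ℝ (Fin d))) 2 (unifSphere d) := by
  refine MemLp.of_bound (C := ‖v‖) ?_ ?_
  · have h : Measurable (fun x : Sph d => inner ℝ v (x : EuclideanSpace ℝ (Fin d))) := by
      fun_prop
    exact h.aestronglyMeasurable
  · refine Eventually.of_forall fun x => ?_
    have hx : ‖(x : EuclideanSpace ℝ (Fin d))‖ = 1 := by simp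
    have h := norm_inner_le_norm (𝕜 := ℝ) v (x : EuclideanSpace ℝ (Fin d))
    rwa [hx, mul_one] at h

/-- The degree-one spherical harmonic `x ↦ ⟨v, x⟩`, as an element of `L²`. -/
def linearHarmonic {d : ℕ} (v : EuclideanSpace ℝ (Fin d)) : Lp ℝ 2 (unifSphere d) :=
  (memLp_linear v).toLp _

/-- The constant function one (the spherical harmonic of degree zero), as an element of `L²`. -/
def constHarmonic (d : ℕ) : Lp ℝ 2 (unifSphere d) :=
  (memLp_const (1 : ℝ)).toLp _

/-- `lam` is the spectrum `λ(T_W) = (λ*_0, λ*_1, …)` of the integral operator, as a real sequence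
converging to zero: every nonzero number occurs as often as the dimension of its eigenspace (so
not at all if it is not an eigenvalue), zeros being free to occur any number of times.
It is labelled as usual: `λ*_0` belongs to the constants, `λ*_1 = ⋯ = λ*_d` to the
spherical harmonics of degree one. -/
structure IsGraphonSpectrum (d : ℕ) (f : LinkFunction) (lam : ℕ → ℝ) : Prop where
  tendsto_zero : Tendsto lam atTop (𝓝 0)
  multiplicity : ∀ μ : ℝ, μ ≠ 0 →
    Cardinal.mk {k : ℕ // lam k = μ} =
      Module.rank ℝ (Module.End.eigenspace (graphonOp d f) μ)
  const_eq : graphonOp d f (constHarmonic d) = lam 0 • constHarmonic d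
  linear_eq : ∀ j ∈ Set.Icc 1 d, ∀ v : EuclideanSpace ℝ (Fin d),
    graphonOp d f (linearHarmonic v) = lam j • linearHarmonic v

/-- The spectral gap `Δ* = Gap₁(W) = inf_{j ∉ {1,…,d}} |λ*_1 - λ*_j|`. -/
def spectralGap (d : ℕ) (lam : ℕ → ℝ) : ℝ :=
  ⨅ j : {j : ℕ // j ∉ Set.Icc 1 d}, |lam 1 - lam j|

/-- `δ₂(x,y) = inf_p (∑ i, (x_i - y_{p(i)})²)^{1/2}`, over all permutations `p` of `ℕ`. -/
def delta2 (x y : ℕ → ℝ) : ℝ≥0∞ :=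
  ⨅ p : Equiv.Perm ℕ, (∑' i, ENNReal.ofReal ((x i - y (p i)) ^ 2)) ^ (1 / 2 : ℝ)

/-- A finite sequence completed with zeros. -/
def padZero {n : ℕ} (μ : Fin n → ℝ) : ℕ → ℝ :=
  fun k => if h : k < n then μ ⟨k, h⟩ else 0

open Classical in
/-- The eigenvalues `λ_0 ≥ λ_1 ≥ ⋯ ≥ λ_{n-1}` of a real symmetric matrix, repeated according to
multiplicity and sorted in decreasing order (zero, by convention, if the matrix is
not symmetric). -/
def sortedEig {n : ℕ} (A : Matrix (Fin n) (Fin n) ℝ) : Fin n → ℝ :=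
  if h : A.IsHermitian then fun i => h.eigenvalues₀ (Fin.cast (Fintype.card_fin n).symm i)
  else 0

/-- The operator norm of a matrix with respect to the Euclidean norm. -/
def opNorm {n : ℕ} (A : Matrix (Fin n) (Fin n) ℝ) : ℝ :=
  ‖Matrix.toEuclideanCLM (n := Fin n) (𝕜 := ℝ) A‖

/-- The normalized probability matrix `T_n = (1/n) (ρ W(X_i, X_j))_{i,j}`. -/
def probMatrix {d n : ℕ} (f : LinkFunction) (ρ : ℝ) (X : Fin n → Sph d) :
    Matrix (Fin n) (Fin n) ℝ :=
  Matrix.of fun i j => (1 / (n : ℝ)) * (ρ * graphon f (X i) (X j))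

/-- The possible values of the normalized adjacency matrix: symmetric, and `n` times each entry is
zero or one. -/
def IsNormalizedAdjacency {n : ℕ} (That : Matrix (Fin n) (Fin n) ℝ) : Prop :=
  That.IsSymm ∧ ∀ i j, (n : ℝ) * That i j = 0 ∨ (n : ℝ) * That i j = 1

/-- The event `ℰ`, as a set of realizations of the latent points and of the adjacency matrix:
`max (δ₂(λ(T_n/ρ), λ(T_W))) (2^{9/2} √d / (ρ Δ*) ‖T_n - T̂_n‖_op) ≤ Δ*/4`. -/
def goodEvent (d : ℕ) (f : LinkFunction) (lam : ℕ → ℝ) (n : ℕ) (ρ : ℝ) :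
    Set ((Fin n → Sph d) × Matrix (Fin n) (Fin n) ℝ) :=
  {ω | delta2 (padZero (sortedEig ((1 / ρ) • probMatrix f ρ ω.1))) lam
        ≤ ENNReal.ofReal (spectralGap d lam / 4) ∧
      (2 : ℝ) ^ (9 / 2 : ℝ) * Real.sqrt d / (ρ * spectralGap d lam) *
          opNorm (probMatrix f ρ ω.1 - ω.2)
        ≤ spectralGap d lam / 4}

/-! Sets of eigenvalues, counted with multiplicity, are represented by sets of indices into the
sorted list of eigenvalues. -/

/-- The distance between the eigenvalues in `S` and the other ones is at least `r`. -/
def SeparatedBy {n : ℕ} (μ : Fin n → ℝ) (S : Finset (Fin n)) (r : ℝ) : Prop :=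
  ∀ i ∈ S, ∀ j ∉ S, r ≤ |μ i - μ j|

/-- The diameter of the set of eigenvalues in `S` is smaller than `r`. -/
def DiamLt {n : ℕ} (μ : Fin n → ℝ) (S : Finset (Fin n)) (r : ℝ) : Prop :=
  ∀ i ∈ S, ∀ j ∈ S, |μ i - μ j| < r

/-- `Gap₁(T̂_n; S)`: the distance between the eigenvalues in `S` and the other ones. -/
def eigGap {n : ℕ} (μ : Fin n → ℝ) (S : Finset (Fin n)) : ℝ :=
  ⨅ i : {i // i ∉ S}, ⨅ j : {j // j ∈ S}, |μ j - μ i|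

/-- The window `{i, i+1, …, i+d-1}` of `d` consecutive indices. -/
def window (n d i : ℕ) : Finset (Fin n) :=
  Finset.univ.filter fun j => i ≤ (j : ℕ) ∧ (j : ℕ) < i + d

open Classical in
/-- The loop of HEiC: the state `(i*, gap)` after `m` passes. It starts from the
window at `1` (the largest eigenvalue, of index `0`, is never a candidate); pass number `m + 1`
looks at the window at `i = m + 2` and keeps it if its gap is larger than the current one. -/
def heicLoop {n : ℕ} (μ : Fin n → ℝ) (d : ℕ) : ℕ → ℕ × ℝ
  | 0 => (1, eigGap μ (window n d 1))
  | m + 1 =>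
    if eigGap μ (window n d (m + 2)) > (heicLoop μ d m).2 then
      (m + 2, eigGap μ (window n d (m + 2)))
    else heicLoop μ d m

/-- The set of eigenvalues selected by HEiC on the input `(T̂_n, d)`: the loop variable runs over
`2 ≤ i ≤ n - d`, that is `n - d - 1` passes. -/
def heicSet {n : ℕ} (That : Matrix (Fin n) (Fin n) ℝ) (d : ℕ) : Finset (Fin n) :=
  window n d (heicLoop (sortedEig That) d (n - d - 1)).1

/-- The columns of `V` are orthonormal, and the column `k` is an eigenvector of `A` for the
eigenvalue number `e k` of the sorted list. -/
def IsEigenvectorMatrix {n : ℕ} {ι : Type} [Fintype ι] [DecidableEq ι]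
    (A : Matrix (Fin n) (Fin n) ℝ) (e : ι → Fin n) (V : Matrix (Fin n) ι ℝ) : Prop :=
  V.transpose * V = 1 ∧ A * V = V * Matrix.diagonal fun k => sortedEig A (e k)

/-- The constant `c₁ = d / (d - 2)` of the addition theorem in degree one
(`c_k = (2k + d - 2) / (d - 2)`). -/
def addConst (d : ℕ) : ℝ := (d : ℝ) / ((d : ℝ) - 2)

/-- The matrix `(1/c₁) V̂ V̂ᵀ`. -/
def gramOf {n : ℕ} {ι : Type} [Fintype ι] (d : ℕ) (V : Matrix (Fin n) ι ℝ) :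
    Matrix (Fin n) (Fin n) ℝ :=
  (1 / addConst d) • (V * V.transpose)

/-- The matrix returned by HEiC on the input `(T̂_n, d)`, when the spectral decomposition it computes
has the eigenvectors `U` (as columns, in the order of the sorted eigenvalues): it keeps the columns
whose index has been selected. -/
def heicGram {n : ℕ} (That : Matrix (Fin n) (Fin n) ℝ) (d : ℕ)
    (U : Matrix (Fin n) (Fin n) ℝ) : Matrix (Fin n) (Fin n) ℝ :=
  gramOf d (U.submatrix id (Subtype.val : {i // i ∈ heicSet That d} → Fin n))

end

/-! Divide all eigenvalues by `ρ` and write `δ` for the spectral gap. On the event, the padded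
spectrum of `T_n` is matched with that of `T_W` by a permutation whose squared errors sum to at most
`(0.26 δ)²`, with a little slack above `δ/4` because the infimum in `delta2` need not be attained.
By Weyl's inequality the spectrum of `T̂_n` differs from that of `T_n` by at most `δ/128` per index;
this uses `δ ≤ |λ*_1| ≤ λ*_0 ≤ 1`. The cluster consists of the indices matched with `{1, …, d}`.
Because the errors are controlled in `ℓ²`, any two of them add up to at most `0.37 δ < δ/2`, which
gives both the diameter and the separation.

Uniqueness needs an arithmetic fact about `W`: a nonzero eigenvalue with index outside `{1, …, d}`
either has index `0` or has multiplicity larger than `d` (`eq_zero_or_lt_ncard`). The values matched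
with one eigenvalue lie within less than `δ/2` of each other, so a separated set that contains one
of them contains all of them; a separated set of `d` values that misses the cluster and stays away
from zero would therefore have at most one element.

The multiplicity bound comes from rotation invariance, without the theory of spherical harmonics:
the reproducing kernel of an eigenspace is zonal, and a bounded zonal function whose rotations span
at most `d` dimensions is affine (`zonal_eq_affine`).

For large `n` more than `d` values crowd around zero, so a separated set of `d` values stays away
from zero automatically. The cluster is a window that does not start at index `0`, hence a candidate
of HEiC; the window of maximal gap is at least as well separated, so uniqueness identifies the two.
-/

/-! ### Min-max comparison and Weyl's inequality for sorted eigenvalues. -/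

/-- Comparison of the sorted eigenvalues of two operators whose quadratic forms are ordered. -/
theorem eigenvalue_le_of_quadraticForm_le {n : ℕ} {E : Type*} [NormedAddCommGroup E]
    [InnerProductSpace ℝ E] (b b' : OrthonormalBasis (Fin n) ℝ E) {a a' : Fin n → ℝ}
    (ha : Antitone a) (ha' : Antitone a') {T T' : E →ₗ[ℝ] E}
    (hT : ∀ i, T (b i) = a i • b i) (hT' : ∀ i, T' (b' i) = a' i • b' i) {r : ℝ}
    (hle : ∀ v, inner ℝ v (T v) ≤ inner ℝ v (T' v) + r * ‖v‖ ^ 2) (i : Fin n) :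
    a i ≤ a' i + r := by
  have key : ∀ (b : OrthonormalBasis (Fin n) ℝ E) (a : Fin n → ℝ) (T : E →ₗ[ℝ] E),
      (∀ i, T (b i) = a i • b i) → ∀ v, inner ℝ v (T v) = ∑ j, a j * inner ℝ (b j) v ^ 2 := by
    intro b a T hT v
    have h1 : T v = ∑ j, (inner ℝ (b j) v * a j) • b j := by
      conv_lhs => rw [← b.sum_repr' v, map_sum]
      simp [hT, smul_smul]
    rw [h1, inner_sum]
    refine Finset.sum_congr rfl fun j _ => ?_
    rw [inner_smul_right, real_inner_comm]; ring
  have hnorm : ∀ (b : OrthonormalBasis (Fin n) ℝ E) v, ‖v‖ ^ 2 = ∑ j, inner ℝ (b j) v ^ 2 := by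
    intro b v
    rw [← b.sum_sq_norm_inner_right v]
    simp
  have : FiniteDimensional ℝ E := b.toBasis.finiteDimensional_of_finite
  -- Courant–Fischer: `n - 1` linear conditions leave a nonzero `v` in the span of the `b j`, `j ≤
  -- i`, and of the `b' j`, `j ≥ i`. Its two Rayleigh quotients are at least `a i` and at most `a'
  -- i`.
  let L : E →ₗ[ℝ] ({j // j ≠ i} → ℝ) := LinearMap.pi fun j =>
    if i < j.1 then (innerₛₗ ℝ (b j.1)) else (innerₛₗ ℝ (b' j.1))
  have hL : LinearMap.ker L ≠ ⊥ := by
    apply LinearMap.ker_ne_bot_of_finrank_lt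
    have h1 : Module.finrank ℝ E = n := by
      simpa using Module.finrank_eq_card_basis b.toBasis
    have h2 : 0 < n := i.pos
    simp only [Module.finrank_fintype_fun_eq_card, h1]
    simp [Fintype.card_subtype_compl]
    omega
  obtain ⟨v, hv, hv0⟩ := Submodule.exists_mem_ne_zero_of_ne_bot hL
  have hvj : ∀ j (hj : j ≠ i), L v ⟨j, hj⟩ = 0 := by
    intro j hj
    rw [LinearMap.mem_ker] at hv
    simp [hv]
  have hb : ∀ j, i < j → inner ℝ (b j) v = 0 := by
    intro j hj
    have := hvj j hj.ne'
    simpa [L, hj] using this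
  have hb' : ∀ j, j < i → inner ℝ (b' j) v = 0 := by
    intro j hj
    have := hvj j hj.ne
    simpa [L, hj.not_gt] using this
  have h1 : a i * ‖v‖ ^ 2 ≤ inner ℝ v (T v) := by
    rw [key b a T hT, hnorm b, Finset.mul_sum]
    refine Finset.sum_le_sum fun j _ => ?_
    rcases lt_or_ge i j with h | h
    · simp [hb j h]
    · exact mul_le_mul_of_nonneg_right (ha h) (sq_nonneg _)
  have h2 : inner ℝ v (T' v) ≤ a' i * ‖v‖ ^ 2 := by
    rw [key b' a' T' hT', hnorm b', Finset.mul_sum]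
    refine Finset.sum_le_sum fun j _ => ?_
    rcases lt_or_ge j i with h | h
    · simp [hb' j h]
    · exact mul_le_mul_of_nonneg_right (ha' h) (sq_nonneg _)
  have h3 : 0 < ‖v‖ ^ 2 := by positivity
  have h4 := hle v
  nlinarith

theorem sortedEig_antitone {n : ℕ} (A : Matrix (Fin n) (Fin n) ℝ) : Antitone (sortedEig A) := by
  classical
  unfold sortedEig
  split_ifs with h
  · intro i j hij
    exact h.eigenvalues₀_antitone (show Fin.cast _ i ≤ Fin.cast _ j from hij)
  · exact antitone_const

/-- A symmetric matrix has an orthonormal eigenbasis for its sorted eigenvalues. -/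
theorem exists_orthonormalBasis_sortedEig {n : ℕ} {A : Matrix (Fin n) (Fin n) ℝ}
    (hA : A.IsHermitian) :
    ∃ b : OrthonormalBasis (Fin n) ℝ (EuclideanSpace ℝ (Fin n)),
      ∀ i, (Matrix.toEuclideanCLM (n := Fin n) (𝕜 := ℝ) A) (b i) = sortedEig A i • b i := by
  classical
  refine ⟨((Matrix.isSymmetric_toEuclideanLin_iff.mpr hA).eigenvectorBasis
    finrank_euclideanSpace).reindex (finCongr (Fintype.card_fin n)), fun i => ?_⟩
  rw [sortedEig, dif_pos hA, OrthonormalBasis.reindex_apply]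
  exact (Matrix.isSymmetric_toEuclideanLin_iff.mpr hA).apply_eigenvectorBasis
    finrank_euclideanSpace _

theorem sortedEig_le_add_opNorm {n : ℕ} {A B : Matrix (Fin n) (Fin n) ℝ}
    (hA : A.IsHermitian) (hB : B.IsHermitian) (i : Fin n) :
    sortedEig A i ≤ sortedEig B i + opNorm (A - B) := by
  obtain ⟨b, hb⟩ := exists_orthonormalBasis_sortedEig hA
  obtain ⟨b', hb'⟩ := exists_orthonormalBasis_sortedEig hB
  refine eigenvalue_le_of_quadraticForm_le b b' (sortedEig_antitone A) (sortedEig_antitone B)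
    (T := (Matrix.toEuclideanCLM (n := Fin n) (𝕜 := ℝ) A).toLinearMap)
    (T' := (Matrix.toEuclideanCLM (n := Fin n) (𝕜 := ℝ) B).toLinearMap) hb hb' (fun v => ?_) i
  have h1 : inner ℝ v ((Matrix.toEuclideanCLM (n := Fin n) (𝕜 := ℝ) (A - B)) v)
      ≤ opNorm (A - B) * ‖v‖ ^ 2 := by
    refine (real_inner_le_norm _ _).trans ?_
    have := (Matrix.toEuclideanCLM (n := Fin n) (𝕜 := ℝ) (A - B)).le_opNorm v
    unfold opNorm
    nlinarith [norm_nonneg v]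
  rw [map_sub, sub_apply, inner_sub_right] at h1
  simp only [ContinuousLinearMap.coe_coe]
  linarith

/-- Weyl's perturbation inequality. -/
theorem abs_sortedEig_sub_le {n : ℕ} {A B : Matrix (Fin n) (Fin n) ℝ}
    (hA : A.IsHermitian) (hB : B.IsHermitian) (i : Fin n) :
    |sortedEig A i - sortedEig B i| ≤ opNorm (A - B) := by
  have h1 := sortedEig_le_add_opNorm hA hB i
  have h2 := sortedEig_le_add_opNorm hB hA i
  have h3 : opNorm (B - A) = opNorm (A - B) := by
    unfold opNorm
    rw [map_sub, map_sub, norm_sub_rev]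
  rw [abs_le]
  constructor <;> linarith

/-- Two decreasing lists of eigenvalues of the same operator coincide, by the comparison with `r =
0` in both directions; `0 ≤ c` keeps the scaled list decreasing. -/
theorem sortedEig_smul {n : ℕ} {A : Matrix (Fin n) (Fin n) ℝ} (hA : A.IsHermitian) {c : ℝ}
    (hc : 0 ≤ c) (i : Fin n) : sortedEig (c • A) i = c * sortedEig A i := by
  have hcA : (c • A).IsHermitian := by
    unfold Matrix.IsHermitian at *
    rw [Matrix.conjTranspose_smul, hA]; simp
  obtain ⟨b, hb⟩ := exists_orthonormalBasis_sortedEig hA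
  obtain ⟨b', hb'⟩ := exists_orthonormalBasis_sortedEig hcA
  set T := (Matrix.toEuclideanCLM (n := Fin n) (𝕜 := ℝ) (c • A)).toLinearMap with hT
  have hbT : ∀ i, T (b i) = (c * sortedEig A i) • b i := by
    intro i
    simp [hT, map_smul, hb, smul_smul]
  have hanti : Antitone fun i => c * sortedEig A i :=
    fun i j hij => mul_le_mul_of_nonneg_left (sortedEig_antitone A hij) hc
  apply le_antisymm
  · simpa using eigenvalue_le_of_quadraticForm_le b' b (sortedEig_antitone _) hanti
      (T := T) (T' := T) hb' hbT (r := 0) (by simp) i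
  · simpa using eigenvalue_le_of_quadraticForm_le b b' hanti (sortedEig_antitone _)
      (T := T) (T' := T) hbT hb' (r := 0) (by simp) i

/-! ### Spectral projections. -/

/-- The spectral projection onto the eigenvalues in a set separated from the rest does not depend
on the choice of the orthonormal eigenvectors. -/
theorem eigenvectorMatrix_mul_transpose_eq {n : ℕ} {A U : Matrix (Fin n) (Fin n) ℝ}
    (hA : A.IsSymm) (hU : IsEigenvectorMatrix A id U) {S : Finset (Fin n)}
    (hS : ∀ i ∈ S, ∀ j ∉ S, sortedEig A i ≠ sortedEig A j) {V : Matrix (Fin n) {i // i ∈ S} ℝ}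
    (hV : IsEigenvectorMatrix A (Subtype.val : {i // i ∈ S} → Fin n) V) :
    U.submatrix id (Subtype.val : {i // i ∈ S} → Fin n) *
      (U.submatrix id (Subtype.val : {i // i ∈ S} → Fin n)).transpose = V * V.transpose := by
  obtain ⟨hU1, hU2⟩ := hU
  obtain ⟨hV1, hV2⟩ := hV
  have hU3 : U * U.transpose = 1 := mul_eq_one_comm.mp hU1
  -- The coordinates of `V` in the eigenbasis `U`. Rows outside `S` vanish because the eigenvalues
  -- differ, so the remaining square block is orthogonal and cancels in `V Vᵀ`.
  set C := U.transpose * V with hC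
  have hUA : U.transpose * A = Matrix.diagonal (sortedEig A) * U.transpose := by
    have := congrArg Matrix.transpose hU2
    rw [Matrix.transpose_mul, Matrix.transpose_mul, hA, Matrix.diagonal_transpose] at this
    simpa using this
  have hCeq : Matrix.diagonal (sortedEig A) * C =
      C * Matrix.diagonal fun k : {i // i ∈ S} => sortedEig A k := by
    rw [hC, ← Matrix.mul_assoc, ← hUA, Matrix.mul_assoc, hV2, Matrix.mul_assoc]
  have hC0 : ∀ i ∉ S, ∀ k, C i k = 0 := by
    intro i hi k
    have h := congrFun (congrFun hCeq i) k
    rw [Matrix.diagonal_mul, Matrix.mul_diagonal] at h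
    have hne := hS k k.2 i hi
    have : (sortedEig A k - sortedEig A i) * C i k = 0 := by linarith
    exact (mul_eq_zero.mp this).resolve_left (sub_ne_zero.mpr hne)
  set U' := U.submatrix id (Subtype.val : {i // i ∈ S} → Fin n) with hU'
  set C' := C.submatrix (Subtype.val : {i // i ∈ S} → Fin n) id with hC'
  have hsum : ∀ g : Fin n → ℝ, (∀ i ∉ S, g i = 0) → ∑ i, g i = ∑ i : {i // i ∈ S}, g i := by
    intro g hg
    rw [← Finset.sum_subset (Finset.subset_univ S) (fun i _ hi => hg i hi)]
    exact (Finset.sum_coe_sort S g).symm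
  have hVU : V = U' * C' := by
    have h1 : V = U * C := by rw [hC, ← Matrix.mul_assoc, hU3, Matrix.one_mul]
    rw [h1]
    ext i k
    rw [Matrix.mul_apply, Matrix.mul_apply, hsum]
    · rfl
    · intro j hj
      rw [hC0 j hj, mul_zero]
  have hCC : C'.transpose * C' = 1 := by
    have h1 : C.transpose * C = 1 := by
      rw [hC, Matrix.transpose_mul, Matrix.transpose_transpose, Matrix.mul_assoc,
        ← Matrix.mul_assoc U, hU3, Matrix.one_mul, hV1]
    rw [← h1]
    ext i k
    rw [Matrix.mul_apply, Matrix.mul_apply, hsum]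
    · rfl
    · intro j hj
      rw [hC0 j hj, mul_zero]
  have hCC' : C' * C'.transpose = 1 := mul_eq_one_comm.mp hCC
  rw [hVU, Matrix.transpose_mul, Matrix.mul_assoc, ← Matrix.mul_assoc C', hCC', Matrix.one_mul]

/-! ### Rotation invariance of the uniform measure. -/

/-- The action of a linear isometry on the unit sphere. -/
noncomputable def sphMap {d : ℕ} (R : EuclideanSpace ℝ (Fin d) ≃ₗᵢ[ℝ] EuclideanSpace ℝ (Fin d))
    (x : Sph d) : Sph d := ⟨R x, by simp⟩

theorem measurable_sphMap {d : ℕ}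
    (R : EuclideanSpace ℝ (Fin d) ≃ₗᵢ[ℝ] EuclideanSpace ℝ (Fin d)) : Measurable (sphMap R) := by
  refine Continuous.measurable ?_
  exact (R.continuous.comp continuous_subtype_val).subtype_mk _

-- The surface measure of a set is a multiple of the Lebesgue measure of the cone over it; a linear
-- isometry maps cones to cones and preserves Lebesgue measure.
open scoped Pointwise in
theorem measurePreserving_sphMap {d : ℕ}
    (R : EuclideanSpace ℝ (Fin d) ≃ₗᵢ[ℝ] EuclideanSpace ℝ (Fin d)) :
    MeasurePreserving (sphMap R) (unifSphere d) (unifSphere d) := by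
  refine ⟨measurable_sphMap R, ?_⟩
  ext s hs
  rw [Measure.map_apply (measurable_sphMap R) hs]
  simp only [unifSphere, Measure.smul_apply]
  congr 1
  rw [Measure.toSphere_apply' _ hs, Measure.toSphere_apply' _ (measurable_sphMap R hs)]
  congr 1
  have h1 : Set.Ioo (0 : ℝ) 1 • (Subtype.val '' (sphMap R ⁻¹' s)) =
      R ⁻¹' (Set.Ioo (0 : ℝ) 1 • (Subtype.val '' s)) := by
    ext z
    simp only [Set.mem_smul, Set.mem_preimage, Set.mem_image]
    constructor
    · rintro ⟨t, ht, _, ⟨y, hy, rfl⟩, rfl⟩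
      exact ⟨t, ht, _, ⟨sphMap R y, hy, rfl⟩, by simp [sphMap]⟩
    · rintro ⟨t, ht, _, ⟨y, hy, rfl⟩, h⟩
      refine ⟨t, ht, _, ⟨sphMap R.symm y, ?_, rfl⟩, ?_⟩
      · have : sphMap R (sphMap R.symm y) = y := by ext; simp [sphMap]
        rwa [this]
      · have : R (t • R.symm (y : EuclideanSpace ℝ (Fin d))) = R z := by
          rw [map_smul, R.apply_symm_apply, h]
        exact R.injective this
  rw [h1]
  exact MeasurePreserving.measure_preimage_equiv (f := R.toHomeomorph.toMeasurableEquiv)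
    R.measurePreserving _

theorem isProbabilityMeasure_unifSphere {d : ℕ} (hd : 0 < d) :
    IsProbabilityMeasure (unifSphere d) := by
  constructor
  rw [unifSphere, Measure.smul_apply, smul_eq_mul]
  refine ENNReal.inv_mul_cancel ?_ (measure_ne_top _ _)
  have : Nontrivial (EuclideanSpace ℝ (Fin d)) :=
    ⟨EuclideanSpace.single ⟨0, hd⟩ 1, 0, by simp⟩
  exact fun h => Measure.toSphere_ne_zero volume (Measure.measure_univ_eq_zero.mp h)

/-- Some coordinate function is nonzero in `L²`. -/
theorem exists_linearHarmonic_ne_zero {d : ℕ} (hd : 0 < d) :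
    ∃ j : Fin d, linearHarmonic (EuclideanSpace.single j (1 : ℝ)) ≠ 0 := by
  have := isProbabilityMeasure_unifSphere hd
  by_contra! h
  have h1 : ∀ j : Fin d, ∀ᵐ (x : Sph d) ∂(unifSphere d), (x : EuclideanSpace ℝ (Fin d)) j = 0 := by
    intro j
    have h2 := (memLp_linear (EuclideanSpace.single j (1 : ℝ))).coeFn_toLp
    have h3 := h j
    unfold linearHarmonic at h3
    rw [h3] at h2
    filter_upwards [h2, Lp.coeFn_zero ℝ 2 (unifSphere d)] with x hx hx0
    rw [hx0] at hx
    simpa [EuclideanSpace.inner_single_left] using hx.symm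
  rw [← ae_all_iff] at h1
  obtain ⟨x, hx⟩ := h1.exists
  have h4 : ‖(x : EuclideanSpace ℝ (Fin d))‖ = 1 := by simp
  have h5 : (x : EuclideanSpace ℝ (Fin d)) = 0 := by ext j; simpa using hx j
  rw [h5, norm_zero] at h4
  exact zero_ne_one h4

/-! ### Size of the eigenvalues of constants and linear functions. -/

theorem coeFn_graphonOp {d : ℕ} (f : LinkFunction) (g : Lp ℝ 2 (unifSphere d)) :
    graphonOp d f g =ᵐ[unifSphere d] fun x => ∫ y, graphon f x y * g y ∂(unifSphere d) :=
  (memLp_graphon_integral f g).coeFn_toLp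

theorem graphon_comm {d : ℕ} (f : LinkFunction) (x y : Sph d) : graphon f x y = graphon f y x := by
  unfold graphon
  rw [real_inner_comm]

theorem integrable_graphon {d : ℕ} (f : LinkFunction) (x : Sph d) :
    Integrable (fun y => graphon f x y) (unifSphere d) := by
  refine Integrable.of_bound (C := 1)
    ((measurable_graphon f).comp measurable_prodMk_left).aestronglyMeasurable
    (Eventually.of_forall fun y => ?_)
  rw [Real.norm_eq_abs, abs_of_nonneg (graphon_nonneg f x y)]
  exact graphon_le_one f x y

namespace IsGraphonSpectrum

variable {d : ℕ} {f : LinkFunction} {lam : ℕ → ℝ}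

theorem integral_graphon (hlam : IsGraphonSpectrum d f lam) :
    ∀ᵐ x ∂(unifSphere d), ∫ y, graphon f x y ∂(unifSphere d) = lam 0 := by
  have h1 := coeFn_graphonOp f (constHarmonic d)
  rw [hlam.const_eq] at h1
  have h2 : constHarmonic d =ᵐ[unifSphere d] fun _ => (1 : ℝ) :=
    (memLp_const (1 : ℝ)).coeFn_toLp
  filter_upwards [h1, Lp.coeFn_smul (lam 0) (constHarmonic d), h2] with x h1 h3 h4
  rw [h3, Pi.smul_apply, h4, smul_eq_mul, mul_one] at h1
  rw [h1]
  refine integral_congr_ae ?_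
  filter_upwards [h2] with y hy
  rw [hy, mul_one]

theorem lam_zero_le_one (hlam : IsGraphonSpectrum d f lam) (hd : 0 < d) : lam 0 ≤ 1 := by
  have := isProbabilityMeasure_unifSphere hd
  obtain ⟨x, hx⟩ := hlam.integral_graphon.exists
  rw [← hx]
  calc ∫ y, graphon f x y ∂(unifSphere d) ≤ ∫ _, (1 : ℝ) ∂(unifSphere d) :=
        integral_mono (integrable_graphon f x) (integrable_const _) fun y => graphon_le_one f x y
    _ = 1 := by simp

theorem lam_eq_lam_one (hlam : IsGraphonSpectrum d f lam) {j : ℕ} (hj : j ∈ Set.Icc 1 d) :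
    lam j = lam 1 := by
  have hd : 0 < d := by have := hj.1; have := hj.2; omega
  obtain ⟨k, hk⟩ := exists_linearHarmonic_ne_zero hd
  have h1 := hlam.linear_eq j hj (EuclideanSpace.single k 1)
  rw [hlam.linear_eq 1 ⟨le_rfl, hd⟩] at h1
  exact (smul_left_injective ℝ hk h1).symm

/-- Schur test in `L¹`: the kernel is nonnegative with almost all row integrals equal to `lam 0`, so
the operator expands the `L¹` norm by at most that factor. Apply this to a nonzero linear
eigenfunction. -/
theorem abs_lam_one_le (hlam : IsGraphonSpectrum d f lam) (hd : 0 < d) : |lam 1| ≤ lam 0 := by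
  have := isProbabilityMeasure_unifSphere hd
  obtain ⟨k, hk⟩ := exists_linearHarmonic_ne_zero hd
  set g := linearHarmonic (EuclideanSpace.single k (1 : ℝ)) with hg
  have hgi : Integrable g (unifSphere d) := (Lp.memLp g).integrable (by norm_num)
  have hprod : Integrable (fun p : Sph d × Sph d => graphon f p.1 p.2 * |g p.2|)
      ((unifSphere d).prod (unifSphere d)) := by
    have h1 : Integrable (fun p : Sph d × Sph d => |g p.2|)
        ((unifSphere d).prod (unifSphere d)) := hgi.abs.comp_snd _
    refine h1.bdd_mul (c := 1) (measurable_graphon f).aestronglyMeasurable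
      (Eventually.of_forall fun p => ?_)
    rw [Real.norm_eq_abs, abs_of_nonneg (graphon_nonneg f _ _)]
    exact graphon_le_one f _ _
  have h1 : ∀ᵐ x ∂(unifSphere d),
      |lam 1| * |g x| ≤ ∫ y, graphon f x y * |g y| ∂(unifSphere d) := by
    have h2 := coeFn_graphonOp f g
    rw [hg, hlam.linear_eq 1 ⟨le_rfl, hd⟩, ← hg] at h2
    filter_upwards [h2, Lp.coeFn_smul (lam 1) g] with x hx hx'
    rw [hx', Pi.smul_apply, smul_eq_mul] at hx
    rw [← abs_mul, hx]
    refine (abs_integral_le_integral_abs).trans (le_of_eq ?_)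
    refine integral_congr_ae (Eventually.of_forall fun y => ?_)
    simp only
    rw [abs_mul, abs_of_nonneg (graphon_nonneg f x y)]
  have h2 : |lam 1| * ∫ x, |g x| ∂(unifSphere d) ≤ lam 0 * ∫ x, |g x| ∂(unifSphere d) := by
    calc |lam 1| * ∫ x, |g x| ∂(unifSphere d)
        = ∫ x, |lam 1| * |g x| ∂(unifSphere d) := (integral_const_mul _ _).symm
      _ ≤ ∫ x, ∫ y, graphon f x y * |g y| ∂(unifSphere d) ∂(unifSphere d) :=
          integral_mono_ae (hgi.abs.const_mul _) hprod.integral_prod_left h1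
      _ = ∫ y, ∫ x, graphon f x y * |g y| ∂(unifSphere d) ∂(unifSphere d) :=
          integral_integral_swap hprod
      _ = ∫ y, lam 0 * |g y| ∂(unifSphere d) := by
          refine integral_congr_ae ?_
          filter_upwards [hlam.integral_graphon] with y hy
          rw [integral_mul_const, ← hy]
          simp_rw [graphon_comm f _ y]
      _ = lam 0 * ∫ x, |g x| ∂(unifSphere d) := integral_const_mul _ _
  have h3 : 0 < ∫ x, |g x| ∂(unifSphere d) := by
    refine lt_of_le_of_ne (integral_nonneg fun x => abs_nonneg _) fun h => hk ?_
    have h4 := (integral_eq_zero_iff_of_nonneg (fun x => abs_nonneg (g x)) hgi.abs).mp h.symm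
    rw [Lp.eq_zero_iff_ae_eq_zero]
    filter_upwards [h4] with x hx
    simpa using hx
  exact le_of_mul_le_mul_right h2 h3

theorem spectralGap_le (_hlam : IsGraphonSpectrum d f lam) {j : ℕ} (hj : j ∉ Set.Icc 1 d) :
    spectralGap d lam ≤ |lam 1 - lam j| :=
  ciInf_le (f := fun j : {j : ℕ // j ∉ Set.Icc 1 d} => |lam 1 - lam j|)
    ⟨0, by rintro _ ⟨j, rfl⟩; exact abs_nonneg _⟩ ⟨j, hj⟩

/-- Since `lam` tends to zero, `|lam 1|` is a limit of the distances over which the gap is the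
infimum. -/
theorem spectralGap_le_abs_lam_one (hlam : IsGraphonSpectrum d f lam) :
    spectralGap d lam ≤ |lam 1| := by
  have h1 : Tendsto (fun j => |lam 1 - lam j|) atTop (𝓝 |lam 1 - 0|) :=
    (hlam.tendsto_zero.const_sub _).abs
  rw [sub_zero] at h1
  refine ge_of_tendsto h1 ?_
  filter_upwards [eventually_gt_atTop d] with j hj
  exact hlam.spectralGap_le fun h => by have := h.2; omega

end IsGraphonSpectrum

/-! ### Zonal functions whose rotations span a small space. -/

theorem card_le_finrank_of_eval {X ι : Type*} [Fintype ι] (V : Submodule ℝ (X → ℝ))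
    [FiniteDimensional ℝ V] (v : ι → X → ℝ) (hv : ∀ i, v i ∈ V)
    (h : ∀ a : ι → ℝ, (∀ y, ∑ i, a i * v i y = 0) → ∀ i, a i = 0) :
    Fintype.card ι ≤ Module.finrank ℝ V := by
  have hli : LinearIndependent ℝ (fun i => (⟨v i, hv i⟩ : V)) := by
    rw [Fintype.linearIndependent_iff]
    intro a ha
    refine h a fun y => ?_
    have h1 := congrArg (fun w : V => (w : X → ℝ) y) ha
    simpa [Submodule.coe_sum, Finset.sum_apply] using h1
  exact hli.fintype_card_le_finrank

/-- A bounded additive function on the unit interval is linear. -/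
theorem eq_mul_of_additive_of_bounded {ψ : ℝ → ℝ} {B : ℝ}
    (hB : ∀ t ∈ Set.Icc (0 : ℝ) 1, |ψ t| ≤ B)
    (hadd : ∀ u v, 0 ≤ u → 0 ≤ v → u + v ≤ 1 → ψ (u + v) = ψ u + ψ v) :
    ∀ t ∈ Set.Icc (0 : ℝ) 1, ψ t = t * ψ 1 := by
  set χ : ℝ → ℝ := fun t => ψ t - t * ψ 1 with hχ
  have hχadd : ∀ u v, 0 ≤ u → 0 ≤ v → u + v ≤ 1 → χ (u + v) = χ u + χ v := by
    intro u v hu hv huv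
    simp only [hχ, hadd u v hu hv huv]; ring
  have hχ1 : χ 1 = 0 := by simp [hχ]
  have hhalf : χ (1 / 2) = 0 := by
    have := hχadd (1 / 2) (1 / 2) (by norm_num) (by norm_num) (by norm_num)
    norm_num [hχ1] at this
    norm_num
    linarith
  -- The deviation `χ` from linearity is additive and vanishes at `1/2` and `1`, so `2 χ(t)` is
  -- again a value of `χ`, at `2t` or `2t - 1`. Each such doubling halves the bound.
  have hbd : ∀ k : ℕ, ∀ t ∈ Set.Icc (0 : ℝ) 1, |χ t| ≤ 2 * B / 2 ^ k := by
    intro k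
    induction k with
    | zero =>
      rintro t ht
      have h1 := hB t ht
      have h2 := hB 1 (by norm_num)
      have h3 : |t * ψ 1| ≤ B := by
        rw [abs_mul, abs_of_nonneg ht.1]
        exact (mul_le_of_le_one_left (abs_nonneg _) ht.2).trans h2
      have h4 := abs_sub (ψ t) (t * ψ 1)
      simp only [hχ, pow_zero, div_one]
      linarith
    | succ k ih =>
      rintro t ⟨ht0, ht1⟩
      have key : ∃ s ∈ Set.Icc (0 : ℝ) 1, χ s = 2 * χ t := by
        rcases le_total t (1 / 2) with h | h
        · refine ⟨t + t, ⟨by linarith, by linarith⟩, ?_⟩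
          rw [hχadd t t ht0 ht0 (by linarith)]; ring
        · refine ⟨(t - 1 / 2) + (t - 1 / 2), ⟨by linarith, by linarith⟩, ?_⟩
          rw [hχadd _ _ (by linarith) (by linarith) (by linarith)]
          have := hχadd (1 / 2) (t - 1 / 2) (by norm_num) (by linarith) (by linarith)
          rw [hhalf, add_sub_cancel] at this
          rw [this]; ring
      obtain ⟨s, hs, hst⟩ := key
      have h1 := ih s hs
      rw [hst, abs_mul, abs_two] at h1
      rw [pow_succ, ← div_div]
      linarith
  intro t ht
  have hlim : Tendsto (fun k : ℕ => 2 * B / (2 : ℝ) ^ k) atTop (𝓝 0) :=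
    tendsto_const_nhds.div_atTop (tendsto_pow_atTop_atTop_of_one_lt (by norm_num))
  have h0 : |χ t| ≤ 0 := ge_of_tendsto' hlim fun k => hbd k t ht
  have h1 : χ t = 0 := abs_eq_zero.mp (le_antisymm h0 (abs_nonneg _))
  simp only [hχ] at h1
  linarith

/-- The point of the sphere with given coordinates. -/
noncomputable def sphPoint {d : ℕ} (v : Fin d → ℝ) (h : ∑ i, v i ^ 2 = 1) : Sph d :=
  ⟨WithLp.toLp 2 v, by
    rw [mem_sphere_zero_iff_norm, EuclideanSpace.norm_eq]
    simp [h]⟩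

theorem inner_sphPoint {d : ℕ} (w : Fin d → ℝ) (hw : ∑ i, w i ^ 2 = 1) (y : Sph d) :
    inner ℝ (sphPoint w hw : EuclideanSpace ℝ (Fin d)) (y : EuclideanSpace ℝ (Fin d))
      = ∑ i, w i * (y : EuclideanSpace ℝ (Fin d)) i := by
  simp [sphPoint, PiLp.inner_apply, mul_comm]

theorem sum_single_mul {d : ℕ} (i : Fin d) (s : ℝ) (w : Fin d → ℝ) :
    ∑ l, (Pi.single i s : Fin d → ℝ) l * w l = s * w i := by
  rw [Finset.sum_eq_single i]
  · simp
  · intro l _ hl; simp [hl]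
  · simp

theorem sum_single_sq {d : ℕ} (i : Fin d) :
    ∑ l, (Pi.single i (1 : ℝ) : Fin d → ℝ) l ^ 2 = 1 := by
  simp_rw [sq]
  rw [sum_single_mul]; simp

theorem sum_two_mul {d : ℕ} (i j : Fin d) (s t : ℝ) (w : Fin d → ℝ) :
    ∑ l, (Pi.single i s + Pi.single j t : Fin d → ℝ) l * w l = s * w i + t * w j := by
  simp_rw [Pi.add_apply, add_mul, Finset.sum_add_distrib, sum_single_mul]

theorem sum_two_sq {d : ℕ} {i j : Fin d} (hij : i ≠ j) {s t : ℝ} (h : s ^ 2 + t ^ 2 = 1) :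
    ∑ l, (Pi.single i s + Pi.single j t : Fin d → ℝ) l ^ 2 = 1 := by
  simp_rw [sq]
  rw [sum_two_mul]
  simp [hij, hij.symm]
  linarith

theorem sum_three_sq {d : ℕ} {i j k : Fin d} (hij : i ≠ j) (hik : i ≠ k) (hjk : j ≠ k)
    {s t r : ℝ} (h : s ^ 2 + t ^ 2 + r ^ 2 = 1) :
    ∑ l, (Pi.single i s + Pi.single j t + Pi.single k r : Fin d → ℝ) l ^ 2 = 1 := by
  simp_rw [sq]
  simp only [Pi.add_apply, add_mul, Finset.sum_add_distrib, sum_single_mul]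
  simp [hij, hij.symm, hik, hik.symm, hjk, hjk.symm]
  linarith

/-- An even zonal function whose rotations span a space of dimension at most `d` is constant. -/
theorem even_zonal_eq_const {m : ℕ} (V : Submodule ℝ (Sph (m + 3) → ℝ)) [FiniteDimensional ℝ V]
    (hV : Module.finrank ℝ V ≤ m + 3) {ψ : ℝ → ℝ} (heven : ∀ t, ψ (-t) = ψ t)
    (hmem : ∀ x : Sph (m + 3), (fun y : Sph (m + 3) =>
      ψ (inner ℝ (x : EuclideanSpace ℝ (Fin (m + 3))) (y : EuclideanSpace ℝ (Fin (m + 3))))) ∈ V)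
    {t : ℝ} (ht : t ∈ Set.Icc (-1 : ℝ) 1) : ψ t = ψ 0 := by
  by_contra hne
  obtain ⟨τ, hτ, hτ1⟩ : ∃ τ ∈ Set.Icc (-1 : ℝ) 1, ψ τ ≠ ψ 1 := by
    by_cases h : ψ t = ψ 1
    · exact ⟨0, by norm_num, fun h0 => hne (h.trans h0.symm)⟩
    · exact ⟨t, ht, h⟩
  obtain ⟨c, s, hcs, hcs'⟩ : ∃ c s : ℝ, c ^ 2 + s ^ 2 = 1 ∧ c ^ 2 - s ^ 2 = τ := by
    refine ⟨√((1 + τ) / 2), √((1 - τ) / 2), ?_, ?_⟩ <;>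
    · rw [Real.sq_sqrt (by linarith [hτ.1]), Real.sq_sqrt (by linarith [hτ.2])]
      ring
  have hcs2 : c ^ 2 + (-s) ^ 2 = 1 := by rw [neg_sq]; exact hcs
  have h0 : ∀ k : Fin (m + 2), (0 : Fin (m + 3)) ≠ k.succ := fun k => (Fin.succ_ne_zero k).symm
  -- If `ψ` is not constant, these `2(m + 2) > m + 3` combinations of rotations are independent.
  -- Comparing the points `c e₀ ± s e_{k+1}` removes the first kind by evenness and isolates one
  -- coefficient of the second.
  let v : Fin (m + 2) ⊕ Fin (m + 2) → Sph (m + 3) → ℝ := Sum.elim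
    (fun k y => ψ ((y : EuclideanSpace ℝ (Fin (m + 3))) k.succ))
    (fun k y => ψ (c * (y : EuclideanSpace ℝ (Fin (m + 3))) 0 + s * y.1 k.succ)
      - ψ (c * (y : EuclideanSpace ℝ (Fin (m + 3))) 0 + -s * y.1 k.succ))
  have hv : ∀ i, v i ∈ V := by
    rintro (k | k)
    · have := hmem (sphPoint _ (sum_single_sq k.succ))
      simp_rw [inner_sphPoint, sum_single_mul, one_mul] at this
      exact this
    · have h1 := hmem (sphPoint _ (sum_two_sq (h0 k) hcs))
      have h2 := hmem (sphPoint _ (sum_two_sq (h0 k) hcs2))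
      simp_rw [inner_sphPoint, sum_two_mul] at h1 h2
      exact V.sub_mem h1 h2
  have hcard := card_le_finrank_of_eval V v hv ?_
  · simp at hcard
    omega
  intro a ha
  have ha' : ∀ w : Fin (m + 3) → ℝ, ∑ i, w i ^ 2 = 1 →
      ∑ k, a (Sum.inl k) * ψ (w k.succ) + ∑ k, a (Sum.inr k) *
        (ψ (c * w 0 + s * w k.succ) - ψ (c * w 0 + -s * w k.succ)) = 0 := by
    intro w hw
    have := ha (sphPoint w hw)
    rw [Fintype.sum_sum_type] at this
    exact this
  have hβ : ∀ k, a (Sum.inr k) = 0 := by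
    intro k
    have h1 := ha' _ (sum_two_sq (h0 k) hcs)
    have h2 := ha' _ (sum_two_sq (h0 k) hcs2)
    have h3 : ∑ j, a (Sum.inl j) * ψ ((Pi.single 0 c + Pi.single k.succ s :
          Fin (m + 3) → ℝ) j.succ) = ∑ j, a (Sum.inl j) *
          ψ ((Pi.single 0 c + Pi.single k.succ (-s) : Fin (m + 3) → ℝ) j.succ) := by
      refine Finset.sum_congr rfl fun j _ => ?_
      by_cases hj : j = k
      · subst hj; simp [heven]
      · simp [hj]
    rw [h3] at h1
    have h4 := sub_eq_zero.mpr (h1.trans h2.symm)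
    rw [add_sub_add_left_eq_sub, ← Finset.sum_sub_distrib, Finset.sum_eq_single k] at h4
    · have e1 : c * c + s * s = 1 := by linarith
      have e2 : c * c + -(s * s) = τ := by linarith
      simp [e1, e2] at h4
      have h5 : a (Sum.inr k) * (ψ 1 - ψ τ) = 0 := by linarith
      exact (mul_eq_zero.mp h5).resolve_right (sub_ne_zero.mpr hτ1.symm)
    · intro j _ hj; simp [hj]
    · simp
  rintro (k | k)
  -- Moving the value `t` from coordinate `k.succ` to coordinate `0`, which the first kind does not
  -- see, isolates the factor `ψ t - ψ 0`.
  · obtain ⟨l, hl⟩ : ∃ l : Fin (m + 2), l ≠ k := exists_ne k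
    have hr : t ^ 2 + √(1 - t ^ 2) ^ 2 = 1 := by
      rw [Real.sq_sqrt (by nlinarith [ht.1, ht.2])]; ring
    have hkl : k.succ ≠ l.succ := by simpa using hl.symm
    have h1 := ha' _ (sum_two_sq hkl hr)
    have h2 := ha' _ (sum_two_sq (h0 l) hr)
    simp only [hβ, zero_mul, Finset.sum_const_zero, add_zero] at h1 h2
    have h3 := sub_eq_zero.mpr (h1.trans h2.symm)
    rw [← Finset.sum_sub_distrib, Finset.sum_eq_single k] at h3
    · simp [hl.symm, (h0 _).symm, ← mul_sub] at h3
      exact h3.resolve_right (sub_ne_zero.mpr hne)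
    · intro j _ hj; simp [hj]
    · simp
  · exact hβ k

/-- An odd bounded zonal function whose rotations span a space of dimension at most `d` is
linear. -/
theorem odd_zonal_eq_linear {m : ℕ} (V : Submodule ℝ (Sph (m + 3) → ℝ)) [FiniteDimensional ℝ V]
    (hV : Module.finrank ℝ V ≤ m + 3) {ψ : ℝ → ℝ} (hodd : ∀ t, ψ (-t) = -ψ t) {B : ℝ}
    (hB : ∀ t ∈ Set.Icc (-1 : ℝ) 1, |ψ t| ≤ B)
    (hmem : ∀ x : Sph (m + 3), (fun y : Sph (m + 3) =>
      ψ (inner ℝ (x : EuclideanSpace ℝ (Fin (m + 3))) (y : EuclideanSpace ℝ (Fin (m + 3))))) ∈ V)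
    {t : ℝ} (ht : t ∈ Set.Icc (-1 : ℝ) 1) : ψ t = t * ψ 1 := by
  by_cases hzero : ∀ t ∈ Set.Icc (-1 : ℝ) 1, ψ t = 0
  · rw [hzero t ht, hzero 1 (by norm_num), mul_zero]
  push Not at hzero
  obtain ⟨t₀, ht₀, hψt₀⟩ := hzero
  have hψ0 : ψ 0 = 0 := by
    have := hodd 0
    rw [neg_zero] at this
    linarith
  have h01 : (0 : Fin (m + 3)) ≠ 1 := by simp
  have h02 : (0 : Fin (m + 3)) ≠ 2 := fun h =>
    absurd (show (0 : ℕ) = 2 from congrArg Fin.val h) (by norm_num)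
  have h12 : (1 : Fin (m + 3)) ≠ 2 := fun h =>
    absurd (show (1 : ℕ) = 2 from congrArg Fin.val h) (by norm_num)
  -- One more rotation than the dimension allows gives a linear relation between `ψ(c y₀ + s y₁)`
  -- and the `ψ(y_k)`.
  have key : ∀ c s : ℝ, c ^ 2 + s ^ 2 = 1 → ∃ p q : ℝ, ∀ y z, y ^ 2 + z ^ 2 ≤ 1 →
      ψ (c * y + s * z) = p * ψ y + q * ψ z := by
    intro c s hcs
    let v : Option (Fin (m + 3)) → Sph (m + 3) → ℝ := fun o => o.elim
      (fun y => ψ (c * (y : EuclideanSpace ℝ (Fin (m + 3))) 0 + s * y.1 1))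
      (fun k y => ψ ((y : EuclideanSpace ℝ (Fin (m + 3))) k))
    have hv : ∀ i, v i ∈ V := by
      rintro (_ | k)
      · have h1 := hmem (sphPoint _ (sum_two_sq h01 hcs))
        simp_rw [inner_sphPoint, sum_two_mul] at h1
        exact h1
      · have := hmem (sphPoint _ (sum_single_sq k))
        simp_rw [inner_sphPoint, sum_single_mul, one_mul] at this
        exact this
    have hdep : ¬ ∀ a : Option (Fin (m + 3)) → ℝ, (∀ y, ∑ i, a i * v i y = 0) → ∀ i, a i = 0 := by
      intro h
      have := card_le_finrank_of_eval V v hv h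
      simp at this
      omega
    push Not at hdep
    obtain ⟨a, ha, hane⟩ := hdep
    have ha' : ∀ w : Fin (m + 3) → ℝ, ∑ i, w i ^ 2 = 1 →
        a none * ψ (c * w 0 + s * w 1) + ∑ k, a (some k) * ψ (w k) = 0 := by
      intro w hw
      have := ha (sphPoint w hw)
      rw [Fintype.sum_option] at this
      exact this
    -- The `ψ(y_k)` alone are independent: adding the values at `t₀ e_j ± r e_l` cancels coordinate
    -- `l` by oddness.
    have hnone : a none ≠ 0 := by
      intro hn
      obtain ⟨i, hi⟩ := hane
      rcases i with _ | j
      · exact hi hn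
      obtain ⟨l, hl⟩ : ∃ l : Fin (m + 3), l ≠ j := exists_ne j
      have hr : t₀ ^ 2 + √(1 - t₀ ^ 2) ^ 2 = 1 := by
        rw [Real.sq_sqrt (by nlinarith [ht₀.1, ht₀.2])]; ring
      have hr' : t₀ ^ 2 + (-√(1 - t₀ ^ 2)) ^ 2 = 1 := by rw [neg_sq]; exact hr
      have h1 := ha' _ (sum_two_sq hl.symm hr)
      have h2 := ha' _ (sum_two_sq hl.symm hr')
      rw [hn, zero_mul, zero_add] at h1 h2
      have h3 : (∑ k, a (some k) * ψ ((Pi.single j t₀ + Pi.single l √(1 - t₀ ^ 2) :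
          Fin (m + 3) → ℝ) k)) + ∑ k, a (some k) * ψ ((Pi.single j t₀ +
            Pi.single l (-√(1 - t₀ ^ 2)) : Fin (m + 3) → ℝ) k) = 0 := by rw [h1, h2, add_zero]
      rw [← Finset.sum_add_distrib, Finset.sum_eq_single j] at h3
      · simp [hl.symm] at h3
        exact h3.elim hi hψt₀
      · intro k _ hk
        by_cases hkl : k = l
        · subst hkl; simp [hk, hodd]
        · simp [hk, hkl, hψ0]
      · simp
    -- The third coordinate fills the vector up to norm one, and averaging over its sign removes its
    -- contribution; this is where dimension at least three enters.
    refine ⟨-a (some 0) / a none, -a (some 1) / a none, fun y z hyz => ?_⟩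
    have hr : y ^ 2 + z ^ 2 + √(1 - (y ^ 2 + z ^ 2)) ^ 2 = 1 := by
      rw [Real.sq_sqrt (by linarith)]; ring
    have hr' : y ^ 2 + z ^ 2 + (-√(1 - (y ^ 2 + z ^ 2))) ^ 2 = 1 := by rw [neg_sq]; exact hr
    have h1 := ha' _ (sum_three_sq h01 h02 h12 hr)
    have h2 := ha' _ (sum_three_sq h01 h02 h12 hr')
    set r := √(1 - (y ^ 2 + z ^ 2))
    have h3 : (∑ k, a (some k) * ψ ((Pi.single 0 y + Pi.single 1 z + Pi.single 2 r :
        Fin (m + 3) → ℝ) k)) + ∑ k, a (some k) * ψ ((Pi.single 0 y + Pi.single 1 z +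
          Pi.single 2 (-r) : Fin (m + 3) → ℝ) k)
        = 2 * (a (some 0) * ψ y) + 2 * (a (some 1) * ψ z) := by
      rw [← Finset.sum_add_distrib, Finset.sum_eq_add 0 1 h01]
      · simp [h01, h01.symm, h02, h12]
        ring
      · intro k _ hk
        by_cases hk2 : k = 2
        · subst hk2; simp [h02.symm, h12.symm, hodd]
        · simp [hk.1, hk.2, hk2, hψ0]
      · simp
      · simp
    have h4 : a none * ψ (c * y + s * z) + (a (some 0) * ψ y + a (some 1) * ψ z) = 0 := by
      simp [h01, h01.symm, h02, h12] at h1 h2 h3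
      linarith
    field_simp
    linarith
  have hadd : ∀ u v, 0 ≤ u → 0 ≤ v → u + v ≤ 1 → ψ (u + v) = ψ u + ψ v := by
    intro u v hu hv huv
    rcases eq_or_lt_of_le (add_nonneg hu hv) with h0 | hpos
    · have hu0 : u = 0 := by linarith
      have hv0 : v = 0 := by linarith
      simp [hu0, hv0, hψ0]
    -- Chosen so that `y = (u + v) c` and `z = (u + v) s` satisfy `c y = u`, `s z = v` and `y² + z²
    -- = (u + v)² ≤ 1`. The relation at `(y, z)`, `(y, 0)` and `(0, z)` then gives additivity.
    have hc2 : √(u / (u + v)) ^ 2 = u / (u + v) := Real.sq_sqrt (by positivity)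
    have hs2 : √(v / (u + v)) ^ 2 = v / (u + v) := Real.sq_sqrt (by positivity)
    set c := √(u / (u + v))
    set s := √(v / (u + v))
    have hcs : c ^ 2 + s ^ 2 = 1 := by
      rw [hc2, hs2]; field_simp
    obtain ⟨p, q, hpq⟩ := key c s hcs
    have e1 : c * ((u + v) * c) = u := by
      have : c * ((u + v) * c) = (u + v) * c ^ 2 := by ring
      rw [this, hc2]; field_simp
    have e2 : s * ((u + v) * s) = v := by
      have : s * ((u + v) * s) = (u + v) * s ^ 2 := by ring
      rw [this, hs2]; field_simp
    have hc' : ((u + v) * c) ^ 2 ≤ 1 ∧ ((u + v) * s) ^ 2 ≤ 1 ∧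
        ((u + v) * c) ^ 2 + ((u + v) * s) ^ 2 ≤ 1 := by
      have e3 : ((u + v) * c) ^ 2 + ((u + v) * s) ^ 2 = (u + v) ^ 2 := by
        have : ((u + v) * c) ^ 2 + ((u + v) * s) ^ 2 = (u + v) ^ 2 * (c ^ 2 + s ^ 2) := by ring
        rw [this, hcs, mul_one]
      have e4 : (u + v) ^ 2 ≤ 1 := by nlinarith
      refine ⟨?_, ?_, ?_⟩ <;> nlinarith [sq_nonneg ((u + v) * c), sq_nonneg ((u + v) * s)]
    have h1 := hpq _ _ hc'.2.2
    have h2 := hpq ((u + v) * c) 0 (by linarith [hc'.1])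
    have h3 := hpq 0 ((u + v) * s) (by linarith [hc'.2.1])
    rw [e1, e2] at h1
    rw [mul_zero, add_zero, e1, hψ0] at h2
    rw [mul_zero, zero_add, e2, hψ0] at h3
    linarith
  have hlin := eq_mul_of_additive_of_bounded
    (fun t ht => hB t ⟨by linarith [ht.1], ht.2⟩) hadd
  rcases le_total 0 t with h | h
  · exact hlin t ⟨h, ht.2⟩
  · have := hlin (-t) ⟨by linarith, by linarith [ht.1]⟩
    rw [hodd] at this
    linarith

/-- A bounded zonal function whose rotations span a space of dimension at most `d` is affine. -/
theorem zonal_eq_affine {d : ℕ} (hd : 3 ≤ d) (V : Submodule ℝ (Sph d → ℝ)) [FiniteDimensional ℝ V]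
    (hV : Module.finrank ℝ V ≤ d) {φ : ℝ → ℝ} {B : ℝ}
    (hB : ∀ t ∈ Set.Icc (-1 : ℝ) 1, |φ t| ≤ B)
    (hmem : ∀ x : Sph d, (fun y : Sph d =>
      φ (inner ℝ (x : EuclideanSpace ℝ (Fin d)) (y : EuclideanSpace ℝ (Fin d)))) ∈ V) :
    ∃ a b : ℝ, ∀ t ∈ Set.Icc (-1 : ℝ) 1, φ t = a + b * t := by
  obtain ⟨m, rfl⟩ : ∃ m, d = m + 3 := ⟨d - 3, by omega⟩
  have hneg : ∀ x : Sph (m + 3), (fun y : Sph (m + 3) => φ (-inner ℝ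
      (x : EuclideanSpace ℝ (Fin (m + 3))) (y : EuclideanSpace ℝ (Fin (m + 3))))) ∈ V := by
    intro x
    have := hmem (-x)
    simpa using this
  have h1 : ∀ t ∈ Set.Icc (-1 : ℝ) 1, φ t + φ (-t) = φ 0 + φ (-0) := fun t ht =>
    even_zonal_eq_const V hV (ψ := fun t => φ t + φ (-t)) (fun t => by simp [add_comm])
      (fun x => V.add_mem (hmem x) (hneg x)) ht
  have h2 : ∀ t ∈ Set.Icc (-1 : ℝ) 1, φ t - φ (-t) = t * (φ 1 - φ (-1)) := fun t ht =>
    odd_zonal_eq_linear V hV (ψ := fun t => φ t - φ (-t)) (fun t => by simp) (B := B + B)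
      (fun t ht => (abs_sub _ _).trans
        (add_le_add (hB t ht) (hB (-t) ⟨by linarith [ht.2], by linarith [ht.1]⟩)))
      (fun x => V.sub_mem (hmem x) (hneg x)) ht
  refine ⟨(φ 0 + φ (-0)) / 2, (φ 1 - φ (-1)) / 2, fun t ht => ?_⟩
  linear_combination (h1 t ht) / 2 + (h2 t ht) / 2

/-! ### Reproducing kernels of eigenspaces and multiplicities. -/

/-- The integral `∫ W(x,y) g(y) dσ(y)` as a function defined at every point of the sphere. -/
noncomputable def graphonEval {d : ℕ} (f : LinkFunction) : Lp ℝ 2 (unifSphere d) →ₗ[ℝ] (Sph d → ℝ) where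
  toFun g x := ∫ y, graphon f x y * g y ∂(unifSphere d)
  map_add' g h := by
    ext x
    rw [Pi.add_apply, ← integral_add (integrable_graphon_mul f g x) (integrable_graphon_mul f h x)]
    refine integral_congr_ae ?_
    filter_upwards [Lp.coeFn_add g h] with y hy
    rw [hy, Pi.add_apply, mul_add]
  map_smul' c g := by
    ext x
    rw [Pi.smul_apply, smul_eq_mul, RingHom.id_apply, ← integral_const_mul]
    refine integral_congr_ae ?_
    filter_upwards [Lp.coeFn_smul c g] with y hy
    rw [hy, Pi.smul_apply, smul_eq_mul]
    ring

theorem graphonOp_ae_eq_graphonEval {d : ℕ} (f : LinkFunction) (g : Lp ℝ 2 (unifSphere d)) :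
    graphonOp d f g =ᵐ[unifSphere d] graphonEval f g :=
  coeFn_graphonOp f g

/-- Composition with an isometry, on `L²` of the sphere. -/
noncomputable def rotate {d : ℕ} (R : EuclideanSpace ℝ (Fin d) ≃ₗᵢ[ℝ] EuclideanSpace ℝ (Fin d)) :
    Lp ℝ 2 (unifSphere d) →ₗᵢ[ℝ] Lp ℝ 2 (unifSphere d) :=
  Lp.compMeasurePreservingₗᵢ ℝ (sphMap R) (measurePreserving_sphMap R)

theorem rotate_ae_eq {d : ℕ} (R : EuclideanSpace ℝ (Fin d) ≃ₗᵢ[ℝ] EuclideanSpace ℝ (Fin d))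
    (g : Lp ℝ 2 (unifSphere d)) : rotate R g =ᵐ[unifSphere d] g ∘ sphMap R :=
  Lp.coeFn_compMeasurePreserving g (measurePreserving_sphMap R)

theorem rotate_rotate {d : ℕ} {R : EuclideanSpace ℝ (Fin d) ≃ₗᵢ[ℝ] EuclideanSpace ℝ (Fin d)}
    (hR : ∀ v, R (R v) = v) (g : Lp ℝ 2 (unifSphere d)) : rotate R (rotate R g) = g := by
  apply Lp.ext
  have h1 := (measurePreserving_sphMap R).quasiMeasurePreserving.ae_eq_comp (rotate_ae_eq R g)
  filter_upwards [rotate_ae_eq R (rotate R g), h1] with x hx hx1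
  rw [hx, hx1]
  simp only [Function.comp_apply]
  congr 1
  ext1
  exact hR x

theorem graphon_sphMap {d : ℕ} (f : LinkFunction)
    (R : EuclideanSpace ℝ (Fin d) ≃ₗᵢ[ℝ] EuclideanSpace ℝ (Fin d)) (x y : Sph d) :
    graphon f (sphMap R x) (sphMap R y) = graphon f x y := by
  unfold graphon sphMap
  rw [LinearIsometryEquiv.inner_map_map]

/-- Valid at every point, not only almost everywhere, which is what rotating the evaluation
functionals of an eigenspace requires. -/
theorem graphonEval_rotate {d : ℕ} (f : LinkFunction)
    (R : EuclideanSpace ℝ (Fin d) ≃ₗᵢ[ℝ] EuclideanSpace ℝ (Fin d)) (g : Lp ℝ 2 (unifSphere d))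
    (x : Sph d) : graphonEval f (rotate R g) x = graphonEval f g (sphMap R x) := by
  have hmp := measurePreserving_sphMap R
  calc ∫ y, graphon f x y * rotate R g y ∂(unifSphere d)
      = ∫ y, graphon f (sphMap R x) (sphMap R y) * g (sphMap R y) ∂(unifSphere d) := by
        refine integral_congr_ae ?_
        filter_upwards [rotate_ae_eq R g] with y hy
        rw [hy, graphon_sphMap, Function.comp_apply]
    _ = ∫ y, graphon f (sphMap R x) y * g y ∂((unifSphere d).map (sphMap R)) := by
        refine (integral_map (f := fun y => graphon f (sphMap R x) y * g y)
          hmp.measurable.aemeasurable ?_).symm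
        rw [hmp.map_eq]
        exact (integrable_graphon_mul f g _).aestronglyMeasurable
    _ = ∫ y, graphon f (sphMap R x) y * g y ∂(unifSphere d) := by rw [hmp.map_eq]

theorem graphonOp_rotate {d : ℕ} (f : LinkFunction)
    (R : EuclideanSpace ℝ (Fin d) ≃ₗᵢ[ℝ] EuclideanSpace ℝ (Fin d)) (g : Lp ℝ 2 (unifSphere d)) :
    graphonOp d f (rotate R g) = rotate R (graphonOp d f g) := by
  apply Lp.ext
  have h1 := (measurePreserving_sphMap R).quasiMeasurePreserving.ae_eq_comp
    (graphonOp_ae_eq_graphonEval f g)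
  filter_upwards [graphonOp_ae_eq_graphonEval f (rotate R g), rotate_ae_eq R (graphonOp d f g), h1]
    with x hx hx1 hx2
  rw [hx, hx1, hx2, graphonEval_rotate, Function.comp_apply]

/-- A kernel on the sphere invariant under all reflections is a function of the inner product. -/
theorem exists_eq_inner_of_invariant {d : ℕ} (k : Sph d → Sph d → ℝ)
    (hk : ∀ R : EuclideanSpace ℝ (Fin d) ≃ₗᵢ[ℝ] EuclideanSpace ℝ (Fin d), (∀ v, R (R v) = v) →
      ∀ x y, k (sphMap R x) (sphMap R y) = k x y) :
    ∃ φ : ℝ → ℝ, ∀ x y : Sph d, k x y =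
      φ (inner ℝ (x : EuclideanSpace ℝ (Fin d)) (y : EuclideanSpace ℝ (Fin d))) := by
  classical
  have key : ∀ x y x' y' : Sph d,
      inner ℝ (x : EuclideanSpace ℝ (Fin d)) (y : EuclideanSpace ℝ (Fin d)) =
        inner ℝ (x' : EuclideanSpace ℝ (Fin d)) (y' : EuclideanSpace ℝ (Fin d)) →
      k x y = k x' y' := by
    intro x y x' y' h
    -- Two reflections carry one pair to the other: the first sends `x` to `x'`; the second sends
    -- the image of `y` to `y'` and fixes `x'`, since the inner products agree.
    set R := (ℝ ∙ ((x : EuclideanSpace ℝ (Fin d)) - x'))ᗮ.reflection with hR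
    have hRx : sphMap R x = x' := by
      ext1
      exact Submodule.reflection_sub (by simp)
    set z := sphMap R y with hz
    have h2 : inner ℝ (x' : EuclideanSpace ℝ (Fin d)) (z : EuclideanSpace ℝ (Fin d)) =
        inner ℝ (x' : EuclideanSpace ℝ (Fin d)) (y' : EuclideanSpace ℝ (Fin d)) := by
      rw [← h, ← hRx]
      exact R.inner_map_map _ _
    set R' := (ℝ ∙ ((z : EuclideanSpace ℝ (Fin d)) - y'))ᗮ.reflection with hR'
    have hRz : sphMap R' z = y' := by
      ext1
      exact Submodule.reflection_sub (by simp)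
    have hRx' : sphMap R' x' = x' := by
      ext1
      refine Submodule.reflection_mem_subspace_eq_self ?_
      rw [Submodule.mem_orthogonal_singleton_iff_inner_left, inner_sub_right, h2, sub_self]
    rw [← hk R (Submodule.reflection_reflection _) x y, hRx, ← hz,
      ← hk R' (Submodule.reflection_reflection _) x' z, hRx', hRz]
  refine ⟨fun t => if h : ∃ p : Sph d × Sph d,
    inner ℝ (p.1 : EuclideanSpace ℝ (Fin d)) (p.2 : EuclideanSpace ℝ (Fin d)) = t then
      k h.choose.1 h.choose.2 else 0, fun x y => ?_⟩
  have h : ∃ p : Sph d × Sph d,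
    inner ℝ (p.1 : EuclideanSpace ℝ (Fin d)) (p.2 : EuclideanSpace ℝ (Fin d)) =
      inner ℝ (x : EuclideanSpace ℝ (Fin d)) (y : EuclideanSpace ℝ (Fin d)) := ⟨(x, y), rfl⟩
  beta_reduce
  rw [dif_pos h]
  exact key _ _ _ _ h.choose_spec.symm

theorem mem_range_inner {d : ℕ} (hd : 2 ≤ d) {t : ℝ} (ht : t ∈ Set.Icc (-1 : ℝ) 1) :
    ∃ x y : Sph d, inner ℝ (x : EuclideanSpace ℝ (Fin d)) (y : EuclideanSpace ℝ (Fin d)) = t := by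
  have h01 : (⟨0, by omega⟩ : Fin d) ≠ ⟨1, by omega⟩ := by simp
  have hr : t ^ 2 + √(1 - t ^ 2) ^ 2 = 1 := by
    rw [Real.sq_sqrt (by nlinarith [ht.1, ht.2])]; ring
  refine ⟨sphPoint _ (sum_single_sq ⟨0, by omega⟩), sphPoint _ (sum_two_sq h01 hr), ?_⟩
  rw [inner_sphPoint, sum_single_mul]
  simp [sphPoint]

namespace IsGraphonSpectrum

variable {d : ℕ} {f : LinkFunction} {lam : ℕ → ℝ}

/-- A small eigenspace, for an eigenvalue other than zero and that of the linear functions,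
consists of constants. -/
theorem eigenspace_le_span_constHarmonic (hlam : IsGraphonSpectrum d f lam) (hd : 3 ≤ d) {μ : ℝ}
    (hμ : μ ≠ 0) (hμ1 : μ ≠ lam 1)
    [FiniteDimensional ℝ (Module.End.eigenspace (graphonOp d f) μ)]
    (hdim : Module.finrank ℝ (Module.End.eigenspace (graphonOp d f) μ) ≤ d) :
    Module.End.eigenspace (graphonOp d f) μ ≤ ℝ ∙ constHarmonic d := by
  set E := Module.End.eigenspace (graphonOp d f) μ with hE
  have hmemE : ∀ g, g ∈ E ↔ graphonOp d f g = μ • g := fun g => Module.End.mem_eigenspace_iff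
  have hev : ∀ g ∈ E, graphonEval f g =ᵐ[unifSphere d] fun x => μ * g x := by
    intro g hg
    have h1 := graphonOp_ae_eq_graphonEval f g
    rw [(hmemE g).mp hg] at h1
    filter_upwards [h1, Lp.coeFn_smul μ g] with x hx hx1
    rw [← hx, hx1, Pi.smul_apply, smul_eq_mul]
  let ev : E →ₗ[ℝ] (Sph d → ℝ) := (graphonEval f).comp E.subtype
  have hevinj : Function.Injective ev := by
    rw [injective_iff_map_eq_zero]
    intro g hg
    have h1 := hev g g.2
    ext1
    rw [ZeroMemClass.coe_zero, Lp.eq_zero_iff_ae_eq_zero]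
    filter_upwards [h1] with x hx
    have h2 : graphonEval f (g : Lp ℝ 2 (unifSphere d)) x = 0 := congrFun hg x
    rw [h2] at hx
    exact (mul_eq_zero.mp hx.symm).resolve_left hμ
  -- Riesz representation of point evaluation on the finite-dimensional eigenspace: up to the factor
  -- `μ`, its reproducing kernel.
  obtain ⟨K, hK⟩ : ∃ K : Sph d → E, ∀ x (g : E), inner ℝ (K x) g = ev g x := by
    refine ⟨fun x => (InnerProductSpace.toDual ℝ E).symm
      (LinearMap.toContinuousLinearMap ((LinearMap.proj x).comp ev)), fun x g => ?_⟩
    rw [InnerProductSpace.toDual_symm_apply]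
    rfl
  have hrotE : ∀ R (g : E), rotate R (g : Lp ℝ 2 (unifSphere d)) ∈ E := by
    intro R g
    rw [hmemE, graphonOp_rotate, (hmemE _).mp g.2, map_smul]
  have hKrot : ∀ R : EuclideanSpace ℝ (Fin d) ≃ₗᵢ[ℝ] EuclideanSpace ℝ (Fin d),
      (∀ v, R (R v) = v) → ∀ x, rotate R (K (sphMap R x) : Lp ℝ 2 (unifSphere d)) = K x := by
    intro R hR x
    suffices h : (⟨_, hrotE R (K (sphMap R x))⟩ : E) = K x from congrArg Subtype.val h
    refine ext_inner_right ℝ fun g => ?_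
    rw [hK, Submodule.coe_inner]
    have h1 : (g : Lp ℝ 2 (unifSphere d)) = rotate R (rotate R g) := (rotate_rotate hR _).symm
    rw [h1]
    simp only [LinearIsometry.inner_map_map]
    have h2 := hK (sphMap R x) ⟨_, hrotE R g⟩
    rw [Submodule.coe_inner] at h2
    rw [h2]
    change graphonEval f (rotate R (g : Lp ℝ 2 (unifSphere d))) (sphMap R x) = graphonEval f _ x
    rw [graphonEval_rotate]
    exact congrArg (graphonEval f _) (Subtype.ext (hR x))
  obtain ⟨φ, hφ⟩ := exists_eq_inner_of_invariant (fun x y => (inner ℝ (K x) (K y) : ℝ)) (by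
    intro R hR x y
    simp only [Submodule.coe_inner]
    rw [← hKrot R hR x, ← hKrot R hR y, LinearIsometry.inner_map_map])
  have hnorm : ∀ x, ‖K x‖ ^ 2 = φ 1 := by
    intro x
    have h1 := hφ x x
    simp only [real_inner_self_eq_norm_sq, norm_eq_of_mem_sphere, one_pow] at h1
    exact h1
  have hbd : ∀ t ∈ Set.Icc (-1 : ℝ) 1, |φ t| ≤ φ 1 := by
    intro t ht
    obtain ⟨x, y, hxy⟩ := mem_range_inner (d := d) (by omega) ht
    rw [← hxy, ← hφ x y]
    have h1 := abs_real_inner_le_norm (K x) (K y)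
    have h2 := hnorm x
    have h3 := hnorm y
    nlinarith [sq_nonneg (‖K x‖ - ‖K y‖)]
  have hevK : ∀ x, ev (K x) = fun y : Sph d =>
      φ (inner ℝ (x : EuclideanSpace ℝ (Fin d)) (y : EuclideanSpace ℝ (Fin d))) := by
    intro x
    ext y
    rw [← hK, hφ y x, real_inner_comm]
  obtain ⟨a, b, hab⟩ := zonal_eq_affine hd (LinearMap.range ev)
    ((LinearMap.finrank_range_le ev).trans hdim) hbd
    (fun x => by rw [← hevK x]; exact LinearMap.mem_range_self _ _)
  have hevK' : ∀ x, ev (K x) = fun y : Sph d => a + b * inner ℝ (x : EuclideanSpace ℝ (Fin d))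
      (y : EuclideanSpace ℝ (Fin d)) := by
    intro x
    rw [hevK]
    ext y
    exact hab _ (inner_sph_mem x y)
  -- Otherwise `K x - K (-x)` is a nonzero multiple of a linear function, whose eigenvalue is `lam 1
  -- ≠ μ`.
  have hb : b = 0 := by
    by_contra hb
    obtain ⟨j, hj⟩ := exists_linearHarmonic_ne_zero (d := d) (by omega)
    set x : Sph d := ⟨EuclideanSpace.single j (1 : ℝ), by simp⟩ with hx
    have h1 : (2 * b) • linearHarmonic (EuclideanSpace.single j (1 : ℝ)) =
        μ • ((K x - K (-x) : E) : Lp ℝ 2 (unifSphere d)) := by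
      apply Lp.ext
      have h2 := (memLp_linear (EuclideanSpace.single j (1 : ℝ))).coeFn_toLp
      filter_upwards [h2, Lp.coeFn_smul (2 * b) (linearHarmonic (EuclideanSpace.single j (1 : ℝ))),
        Lp.coeFn_smul μ ((K x - K (-x) : E) : Lp ℝ 2 (unifSphere d)),
        hev _ (K x - K (-x)).2] with y h2 h3 h4 h5
      rw [h3, h4, Pi.smul_apply, Pi.smul_apply, smul_eq_mul, smul_eq_mul, ← h5]
      unfold linearHarmonic
      rw [h2]
      have h6 : graphonEval f ((K x - K (-x) : E) : Lp ℝ 2 (unifSphere d)) y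
          = ev (K x) y - ev (K (-x)) y := by
        rw [← Pi.sub_apply, ← map_sub]; rfl
      rw [h6, hevK', hevK']
      have h7 : ((-x : Sph d) : EuclideanSpace ℝ (Fin d)) = -EuclideanSpace.single j (1 : ℝ) := rfl
      simp only [h7, inner_neg_left]
      ring
    have h2 : (2 * b) • linearHarmonic (EuclideanSpace.single j (1 : ℝ)) ∈ E := by
      rw [h1]
      exact E.smul_mem _ (K x - K (-x)).2
    rw [hmemE, map_smul, hlam.linear_eq 1 ⟨le_rfl, by omega⟩, smul_smul, smul_smul] at h2
    have h3 := smul_left_injective ℝ hj h2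
    have h4 : (2 * b) * (lam 1 - μ) = 0 := by linarith
    rcases mul_eq_zero.mp h4 with h5 | h5
    · exact hb (by linarith)
    · exact hμ1 (by linarith)
  have hKconst : ∀ x y, K x = K y := by
    intro x y
    apply hevinj
    rw [hevK', hevK', hb]
    simp
  intro g hg
  have := isProbabilityMeasure_unifSphere (d := d) (by omega)
  obtain ⟨x₀, -⟩ := hlam.integral_graphon.exists
  rw [Submodule.mem_span_singleton]
  refine ⟨μ⁻¹ * ev ⟨g, hg⟩ x₀, ?_⟩
  apply Lp.ext
  have h2 : constHarmonic d =ᵐ[unifSphere d] fun _ => (1 : ℝ) :=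
    (memLp_const (1 : ℝ)).coeFn_toLp
  filter_upwards [h2, Lp.coeFn_smul (μ⁻¹ * ev ⟨g, hg⟩ x₀) (constHarmonic d), hev g hg]
    with y h2 h3 h4
  have h5 : ev ⟨g, hg⟩ x₀ = graphonEval f g y := by
    rw [← hK, hKconst x₀ y, hK]; rfl
  rw [h3, Pi.smul_apply, h2, smul_eq_mul, mul_one, h5, h4, inv_mul_cancel_left₀ hμ]

theorem finite_setOf_eq (hlam : IsGraphonSpectrum d f lam) {μ : ℝ} (hμ : μ ≠ 0) :
    {j | lam j = μ}.Finite := by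
  have h1 : ∀ᶠ j in cofinite, lam j ≠ μ := by
    rw [Nat.cofinite_eq_atTop]
    exact hlam.tendsto_zero.eventually_ne hμ.symm
  simpa using h1

/-- Apart from those of the constants and of the linear functions, every nonzero eigenvalue has
multiplicity larger than `d`. -/
theorem eq_zero_or_lt_ncard (hlam : IsGraphonSpectrum d f lam) (hd : 3 ≤ d)
    (hgap : 0 < spectralGap d lam) {k : ℕ} (hk : k ∉ Set.Icc 1 d) (hne : lam k ≠ 0) :
    k = 0 ∨ d < {j | lam j = lam k}.ncard := by
  by_contra! hcon
  obtain ⟨hk0, hcard⟩ := hcon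
  have hfin := hlam.finite_setOf_eq hne
  have hrank := hlam.multiplicity (lam k) hne
  set E := Module.End.eigenspace (graphonOp d f) (lam k) with hE
  have hFD : FiniteDimensional ℝ E := by
    rw [FiniteDimensional, ← Module.rank_lt_aleph0_iff, ← hrank, Cardinal.lt_aleph0_iff_finite]
    exact hfin.to_subtype
  have hfinrank : Module.finrank ℝ E = {j | lam j = lam k}.ncard := by
    rw [Module.finrank, ← hrank]
    rfl
  have hk1 : lam k ≠ lam 1 := by
    intro h
    have := hlam.spectralGap_le hk
    rw [h, sub_self, abs_zero] at this
    linarith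
  have hle := hlam.eigenspace_le_span_constHarmonic hd hne hk1 (hfinrank.trans_le hcard)
  have hpos : 0 < Module.finrank ℝ E := by
    rw [hfinrank, Set.ncard_pos hfin]
    exact ⟨k, rfl⟩
  have : Nontrivial E := Module.nontrivial_of_finrank_pos hpos
  obtain ⟨g, hg0⟩ := exists_ne (0 : E)
  obtain ⟨c, hc⟩ := Submodule.mem_span_singleton.mp (hle g.2)
  have hg0' : (g : Lp ℝ 2 (unifSphere d)) ≠ 0 := by simpa using hg0
  have h0 : lam 0 = lam k := by
    have h1 : graphonOp d f g = lam k • (g : Lp ℝ 2 (unifSphere d)) :=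
      Module.End.mem_eigenspace_iff.mp g.2
    have h2 : graphonOp d f g = lam 0 • (g : Lp ℝ 2 (unifSphere d)) := by
      rw [← hc, map_smul, hlam.const_eq, smul_comm]
    exact smul_left_injective ℝ hg0' (h2.symm.trans h1)
  have hconst : constHarmonic d ≠ 0 := by
    intro h
    rw [h, smul_zero] at hc
    exact hg0' hc.symm
  have h1 : Module.finrank ℝ E ≤ 1 :=
    (Submodule.finrank_mono hle).trans (finrank_span_singleton hconst).le
  rw [hfinrank] at h1
  -- The eigenspace is the line of constants, so `lam 0 = lam k` with multiplicity one, which forces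
  -- `k = 0`.
  have := (Set.ncard_le_one hfin).mp h1 0 h0 k rfl
  exact hk0 this.symm

end IsGraphonSpectrum

/-! ### The window search of HEiC -/

theorem card_window {n d i : ℕ} (h : i + d ≤ n) : (window n d i).card = d := by
  have h1 : (window n d i).map Fin.valEmbedding = Finset.Ico i (i + d) := by
    ext k
    simp only [window, Finset.mem_map, Finset.mem_filter, Finset.mem_univ, true_and,
      Fin.valEmbedding_apply, Finset.mem_Ico]
    constructor
    · rintro ⟨j, hj, rfl⟩; exact hj
    · intro hk; exact ⟨⟨k, by omega⟩, hk, rfl⟩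
  rw [← Finset.card_map Fin.valEmbedding, h1, Nat.card_Ico]
  omega

/-- `S` and its complement must be nonempty, because a real infimum over an empty type is `0`. -/
theorem le_eigGap_iff {n : ℕ} {μ : Fin n → ℝ} {S : Finset (Fin n)} (hS : S.Nonempty)
    (hSn : S.card < n) {r : ℝ} : r ≤ eigGap μ S ↔ SeparatedBy μ S r := by
  have hne : Nonempty {j // j ∈ S} := hS.to_subtype
  have hne' : Nonempty {i // i ∉ S} := by
    by_contra hcon
    have : S = Finset.univ := by
      ext i
      simpa using fun hi => hcon ⟨⟨i, hi⟩⟩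
    rw [this, Finset.card_univ, Fintype.card_fin] at hSn
    exact lt_irrefl _ hSn
  constructor
  · intro h i hi j hj
    refine h.trans ((ciInf_le (Set.finite_range _).bddBelow ⟨j, hj⟩).trans ?_)
    exact ciInf_le (f := fun k : {j // j ∈ S} => |μ k - μ j|) (Set.finite_range _).bddBelow ⟨i, hi⟩
  · intro h
    exact le_ciInf fun j => le_ciInf fun i => h i i.2 j j.2

/-- Loop invariant of a running maximum. How ties are broken is left open, since uniqueness of the
separated set settles them. -/
theorem heicLoop_spec {n : ℕ} (μ : Fin n → ℝ) (d m : ℕ) :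
    (1 ≤ (heicLoop μ d m).1 ∧ (heicLoop μ d m).1 ≤ m + 1) ∧
      (heicLoop μ d m).2 = eigGap μ (window n d (heicLoop μ d m).1) ∧
      ∀ i, 1 ≤ i → i ≤ m + 1 → eigGap μ (window n d i) ≤ (heicLoop μ d m).2 := by
  induction m with
  | zero =>
    refine ⟨⟨le_rfl, le_rfl⟩, rfl, fun i h1 h2 => ?_⟩
    have : i = 1 := by omega
    subst this
    exact le_rfl
  | succ m ih =>
    obtain ⟨⟨h1, h2⟩, h3, h4⟩ := ih
    rw [heicLoop]
    split_ifs with h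
    · refine ⟨⟨by simp, by simp⟩, rfl, fun i hi1 hi2 => ?_⟩
      rcases Nat.lt_or_ge i (m + 2) with hi | hi
      · exact (h4 i hi1 (by omega)).trans h.le
      · have : i = m + 2 := by omega
        subst this
        exact le_rfl
    · refine ⟨⟨h1, by omega⟩, h3, fun i hi1 hi2 => ?_⟩
      rcases Nat.lt_or_ge i (m + 2) with hi | hi
      · exact h4 i hi1 (by omega)
      · have : i = m + 2 := by omega
        subst this
        exact not_lt.mp h

/-- A cluster of sorted eigenvalues separated from the others is a window. -/
theorem eq_window_of_separated {n d : ℕ} (hd : 0 < d) {μ : Fin n → ℝ} (hμ : Antitone μ)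
    {S : Finset (Fin n)} (hcard : S.card = d) {r : ℝ} (hdiam : DiamLt μ S r)
    (hsep : SeparatedBy μ S r) :
    ∃ a : Fin n, a ∈ S ∧ (a : ℕ) + d ≤ n ∧ S = window n d a := by
  have hne : S.Nonempty := Finset.card_pos.mp (by omega)
  set a := S.min' hne
  set b := S.max' hne
  have ha : a ∈ S := S.min'_mem hne
  have hb : b ∈ S := S.max'_mem hne
  have hS : S = Finset.Icc a b := by
    ext i
    rw [Finset.mem_Icc]
    constructor
    · exact fun hi => ⟨S.min'_le i hi, S.le_max' i hi⟩
    · rintro ⟨h1, h2⟩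
      -- By monotonicity an index skipped by `S` would be closer to `a` than the diameter allows.
      by_contra hi
      have h3 := hsep a ha i hi
      have h4 := hdiam a ha b hb
      have h5 := hμ h1
      have h6 := hμ h2
      rw [abs_of_nonneg (by linarith)] at h3 h4
      linarith
  have hab : a ≤ b := S.min'_le b hb
  have hc : (b : ℕ) + 1 - a = d := by
    rw [← hcard, hS, Fin.card_Icc]
  have hab' : (a : ℕ) ≤ b := hab
  refine ⟨a, ha, by have := b.2; omega, ?_⟩
  rw [hS]
  ext i
  simp only [Finset.mem_Icc, window, Finset.mem_filter, Finset.mem_univ, true_and, Fin.le_def]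
  omega

/-- The window search finds the unique separated set of eigenvalues. -/
theorem window_heicLoop_eq {n d : ℕ} (hd : 0 < d) (hdn : d < n) {μ : Fin n → ℝ} (hμ : Antitone μ)
    {S : Finset (Fin n)} (hcard : S.card = d) {r : ℝ} (hdiam : DiamLt μ S r)
    (hsep : SeparatedBy μ S r) (h0 : ∀ i ∈ S, (i : ℕ) ≠ 0)
    (huniq : ∀ S' : Finset (Fin n), S'.card = d → SeparatedBy μ S' r → S' = S) :
    window n d (heicLoop μ d (n - d - 1)).1 = S := by
  obtain ⟨a, ha, han, hSa⟩ := eq_window_of_separated hd hμ hcard hdiam hsep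
  obtain ⟨⟨h1, h2⟩, h3, h4⟩ := heicLoop_spec μ d (n - d - 1)
  have ha0 := h0 a ha
  have hgap := h4 a (by omega) (by omega)
  rw [← hSa, h3] at hgap
  have hcard' := card_window (n := n) (d := d) (i := (heicLoop μ d (n - d - 1)).1) (by omega)
  refine huniq _ hcard' ?_
  rw [← le_eigGap_iff (Finset.card_pos.mp (by omega)) (by omega)]
  refine le_trans ?_ hgap
  rwa [le_eigGap_iff (Finset.card_pos.mp (by omega)) (by omega)]

/-! ### Matching of spectra -/

/-- The strict inequality `a < r` pays for an infimum that may not be attained; finite partial sums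
avoid any question of summability. -/
theorem exists_perm_of_delta2_le {x y : ℕ → ℝ} {a r : ℝ} (h : delta2 x y ≤ ENNReal.ofReal a)
    (har : a < r) (hr : 0 < r) :
    ∃ p : Equiv.Perm ℕ, ∀ s : Finset ℕ, ∑ i ∈ s, (x i - y (p i)) ^ 2 ≤ r ^ 2 := by
  have h1 : delta2 x y < ENNReal.ofReal r :=
    h.trans_lt ((ENNReal.ofReal_lt_ofReal_iff hr).mpr har)
  obtain ⟨p, hp⟩ := iInf_lt_iff.mp h1
  refine ⟨p, fun s => ?_⟩
  have h2 : ∑' i, ENNReal.ofReal ((x i - y (p i)) ^ 2) ≤ ENNReal.ofReal (r ^ 2) := by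
    have h3 := ENNReal.rpow_le_rpow hp.le (show (0 : ℝ) ≤ 2 by norm_num)
    rw [← ENNReal.rpow_mul, ENNReal.ofReal_rpow_of_pos hr] at h3
    norm_num at h3
    exact h3
  have h4 := (ENNReal.sum_le_tsum s).trans h2
  rw [← ENNReal.ofReal_sum_of_nonneg (fun i _ => sq_nonneg _)] at h4
  exact (ENNReal.ofReal_le_ofReal_iff (sq_nonneg r)).mp h4

theorem abs_le_of_sum_sq_le {z : ℕ → ℝ} {r : ℝ} (hr : 0 ≤ r)
    (h : ∀ s : Finset ℕ, ∑ i ∈ s, z i ^ 2 ≤ r ^ 2) (i : ℕ) : |z i| ≤ r := by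
  have := h {i}
  rw [Finset.sum_singleton] at this
  exact abs_le_of_sq_le_sq this hr

/-- Cauchy–Schwarz, with `√2 · 0.26 < 0.37`. A uniform bound on the errors would only give `0.52 δ`,
too much for separation by `δ/2`. -/
theorem abs_add_abs_le_of_sum_sq_le {z : ℕ → ℝ} {δ : ℝ} (hδ : 0 ≤ δ)
    (h : ∀ s : Finset ℕ, ∑ i ∈ s, z i ^ 2 ≤ (0.26 * δ) ^ 2) {i j : ℕ} (hij : i ≠ j) :
    |z i| + |z j| ≤ 0.37 * δ := by
  have := h {i, j}
  rw [Finset.sum_pair hij, ← sq_abs (z i), ← sq_abs (z j)] at this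
  refine le_of_sq_le_sq ?_ (by positivity)
  nlinarith [sq_nonneg (|z i| - |z j|), sq_nonneg δ]

theorem card_mul_sq_le_of_sum_sq_le {z : ℕ → ℝ} {r η : ℝ} (hη : 0 ≤ η)
    (h : ∀ s : Finset ℕ, ∑ i ∈ s, z i ^ 2 ≤ r ^ 2) (s : Finset ℕ) (hs : ∀ i ∈ s, η ≤ |z i|) :
    s.card * η ^ 2 ≤ r ^ 2 := by
  refine le_trans ?_ (h s)
  rw [← nsmul_eq_mul]
  refine Finset.card_nsmul_le_sum _ _ _ fun i hi => ?_
  rw [← sq_abs (z i)]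
  exact pow_le_pow_left₀ hη (hs i hi) 2

/-- A sequence `x` vanishing from `n` on is matched by the permutation `p` with the spectrum `lam`,
which has gap `δ` around its entries `1, …, d`, and `y` is a perturbation of `x`. -/
structure IsMatched (d n : ℕ) (lam : ℕ → ℝ) (δ : ℝ) (x : ℕ → ℝ) (y : Fin n → ℝ)
    (p : Equiv.Perm ℕ) : Prop where
  three_le : 3 ≤ d
  pos : 0 < δ
  lam_eq : ∀ j ∈ Set.Icc 1 d, lam j = lam 1
  gap : ∀ j ∉ Set.Icc 1 d, δ ≤ |lam 1 - lam j|
  le_abs : δ ≤ |lam 1|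
  abs_le : |lam 1| ≤ lam 0
  mult : ∀ k ∉ Set.Icc 1 d, lam k ≠ 0 → k = 0 ∨ d < {j | lam j = lam k}.ncard
  near : ∀ i : Fin n, |x i - y i| ≤ δ / 128
  zero : ∀ i, n ≤ i → x i = 0
  sum_le : ∀ s : Finset ℕ, ∑ i ∈ s, (x i - lam (p i)) ^ 2 ≤ (0.26 * δ) ^ 2

namespace IsMatched

variable {d n : ℕ} {lam : ℕ → ℝ} {δ : ℝ} {x : ℕ → ℝ} {y : Fin n → ℝ} {p : Equiv.Perm ℕ}

theorem abs_sub_lam_le (h : IsMatched d n lam δ x y p) (i : ℕ) : |x i - lam (p i)| ≤ 0.26 * δ :=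
  abs_le_of_sum_sq_le (by have := h.pos; positivity) h.sum_le i

theorem abs_sub_lam_add_le (h : IsMatched d n lam δ x y p) {i j : ℕ} (hij : i ≠ j) :
    |x i - lam (p i)| + |x j - lam (p j)| ≤ 0.37 * δ :=
  abs_add_abs_le_of_sum_sq_le h.pos.le h.sum_le hij

theorem abs_sub_le_of_lam_eq (h : IsMatched d n lam δ x y p) {i j : ℕ}
    (hij : lam (p i) = lam (p j)) : |x i - x j| ≤ 0.37 * δ := by
  have hδ := h.pos
  rcases eq_or_ne i j with rfl | hne
  · rw [sub_self, abs_zero]; positivity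
  · have h1 := h.abs_sub_lam_add_le hne
    have h2 := abs_sub (x i - lam (p i)) (x j - lam (p j))
    have h3 : (x i - lam (p i)) - (x j - lam (p j)) = x i - x j := by rw [hij]; ring
    rw [h3] at h2
    linarith

/-- Membership in the cluster, in terms of the matching. -/
theorem abs_sub_lam_one_le_iff (h : IsMatched d n lam δ x y p) (i : ℕ) :
    |x i - lam 1| ≤ 0.26 * δ ↔ p i ∈ Set.Icc 1 d := by
  have hδ := h.pos
  have h1 := h.abs_sub_lam_le i
  constructor
  · intro hi
    by_contra hcon
    have h2 := h.gap _ hcon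
    have h3 := abs_sub_le (lam 1) (x i) (lam (p i))
    rw [abs_sub_comm (lam 1) (x i)] at h3
    linarith
  · intro hi
    rwa [h.lam_eq _ hi] at h1

variable {Λ : Finset (Fin n)}

/-- No padding zero can be matched with the cluster, since zero is at distance at least `δ` from
`lam 1`; so all `d` matched indices are below `n`. -/
theorem card_eq (h : IsMatched d n lam δ x y p) (hΛ : ∀ i, i ∈ Λ ↔ p i ∈ Set.Icc 1 d) :
    Λ.card = d := by
  have h1 : Λ.map (Fin.valEmbedding.trans p.toEmbedding) = Finset.Icc 1 d := by
    ext j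
    simp only [Finset.mem_map, Function.Embedding.trans_apply, Fin.valEmbedding_apply,
      Equiv.coe_toEmbedding]
    constructor
    · rintro ⟨i, hi, rfl⟩
      simpa using (hΛ i).mp hi
    · intro hj
      have hp : p (p.symm j) ∈ Set.Icc 1 d := by simpa using hj
      have hlt : p.symm j < n := by
        by_contra hcon
        have h2 := (h.abs_sub_lam_one_le_iff _).mpr hp
        rw [h.zero _ (not_lt.mp hcon), zero_sub, abs_neg] at h2
        have := h.le_abs
        have := h.pos
        linarith
      exact ⟨⟨p.symm j, hlt⟩, (hΛ _).mpr hp, by simp⟩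
  rw [← Finset.card_map (Fin.valEmbedding.trans p.toEmbedding), h1, Nat.card_Icc]
  rfl

/-- Numerically, `0.37 + 2/128 < 1/2`. -/
theorem diamLt (h : IsMatched d n lam δ x y p) (hΛ : ∀ i, i ∈ Λ ↔ p i ∈ Set.Icc 1 d) :
    DiamLt y Λ (δ / 2) := by
  intro i hi j hj
  have hδ := h.pos
  have h1 := h.abs_sub_le_of_lam_eq (i := i) (j := j)
    ((h.lam_eq _ ((hΛ i).mp hi)).trans (h.lam_eq _ ((hΛ j).mp hj)).symm)
  have h2 := _root_.abs_le.mp (h.near i)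
  have h3 := _root_.abs_le.mp (h.near j)
  have h4 := _root_.abs_le.mp h1
  rw [abs_lt]
  constructor <;> linarith [h2.1, h2.2, h3.1, h3.2, h4.1, h4.2]

/-- Two matching errors and two perturbations come off the gap: `1 - 0.37 - 2/128 > 1/2`. -/
theorem separatedBy (h : IsMatched d n lam δ x y p) (hΛ : ∀ i, i ∈ Λ ↔ p i ∈ Set.Icc 1 d) :
    SeparatedBy y Λ (δ / 2) := by
  intro i hi j hj
  have hδ := h.pos
  have hij : (i : ℕ) ≠ j := fun hij => hj (Fin.ext hij ▸ hi)
  have h1 := h.gap _ (fun hp => hj ((hΛ j).mpr hp))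
  have h2 := h.abs_sub_lam_add_le hij
  rw [h.lam_eq _ ((hΛ i).mp hi)] at h2
  have h3 : lam 1 - lam (p j) = -(x i - lam 1) + (x i - y i) + (y i - y j) + -(x j - y j) +
      (x j - lam (p j)) := by ring
  have h4 := abs_add_le (-(x i - lam 1) + (x i - y i) + (y i - y j) + -(x j - y j))
    (x j - lam (p j))
  have h5 := abs_add_le (-(x i - lam 1) + (x i - y i) + (y i - y j)) (-(x j - y j))
  have h6 := abs_add_le (-(x i - lam 1) + (x i - y i)) (y i - y j)
  have h7 := abs_add_le (-(x i - lam 1)) (x i - y i)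
  rw [abs_neg] at h5 h7
  have h8 := h.near i
  have h9 := h.near j
  rw [← h3] at h4
  linarith

theorem le_abs_of_mem (h : IsMatched d n lam δ x y p) (hΛ : ∀ i, i ∈ Λ ↔ p i ∈ Set.Icc 1 d)
    {i : Fin n} (hi : i ∈ Λ) : δ / 2 ≤ |y i| := by
  have hδ := h.pos
  have h1 := h.abs_sub_lam_le i
  rw [h.lam_eq _ ((hΛ i).mp hi)] at h1
  have h2 := h.near i
  have h3 := h.le_abs
  have h4 := abs_sub_abs_le_abs_sub (lam 1) (y i)
  have h5 := abs_sub_le (lam 1) (x i) (y i)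
  rw [abs_sub_comm (lam 1) (x i)] at h5
  linarith

/-- The cluster is the only separated set of `d` eigenvalues away from zero. -/
theorem eq_of_separatedBy (h : IsMatched d n lam δ x y p) (hΛ : ∀ i, i ∈ Λ ↔ p i ∈ Set.Icc 1 d)
    {S : Finset (Fin n)} (hcard : S.card = d) (hsep : SeparatedBy y S (δ / 2))
    (hzero : ∀ i ∈ S, 0.45 * δ ≤ |y i|) : S = Λ := by
  have hδ := h.pos
  have hd := h.three_le
  -- A separated set meeting the cluster contains it, as the diameter is below `δ/2`. The bound
  -- `0.45 δ` away from zero, weaker than `δ/2`, also serves the case of large `n`.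
  by_cases hmeet : ∃ i ∈ S, i ∈ Λ
  · obtain ⟨i, hi, hiΛ⟩ := hmeet
    have hsub : Λ ⊆ S := by
      intro j hj
      by_contra hjS
      have h1 := hsep i hi j hjS
      have h2 := h.diamLt hΛ i hiΛ j hj
      linarith
    exact (Finset.eq_of_subset_of_card_le hsub (by rw [hcard, h.card_eq hΛ])).symm
  exfalso
  push Not at hmeet
  have hp0 : ∀ i ∈ S, p i = 0 := by
    intro i hi
    have h1 := h.abs_sub_lam_le i
    have h2 := h.near i
    have h3 := hzero i hi
    have h4 := abs_sub_abs_le_abs_sub (y i) (x i)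
    have h5 := abs_sub_abs_le_abs_sub (x i) (lam (p i))
    rw [abs_sub_comm (y i)] at h4
    have hne : lam (p i) ≠ 0 := by
      intro h0
      rw [h0, abs_zero] at h5
      rw [h0] at h1
      linarith
    refine (h.mult _ (fun hp => hmeet i hi ((hΛ i).mpr hp)) hne).resolve_right fun hlt => ?_
    -- All values matched with this eigenvalue are within `(0.37 + 2/128) δ < δ/2` of `y i`, hence
    -- in `S`; padding zeros are too far from `x i`. That is more than `d` elements.
    have hsub : {j | lam j = lam (p i)} ⊆
        ((S.map (Fin.valEmbedding.trans p.toEmbedding) : Finset ℕ) : Set ℕ) := by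
      intro j hj
      have hj' : lam (p (p.symm j)) = lam (p i) := by simpa using hj
      have h6 := h.abs_sub_le_of_lam_eq hj'
      have hjn : p.symm j < n := by
        by_contra hcon
        rw [h.zero _ (not_lt.mp hcon), zero_sub, abs_neg] at h6
        linarith
      have hjS : (⟨p.symm j, hjn⟩ : Fin n) ∈ S := by
        by_contra hcon
        have h7 := hsep i hi _ hcon
        have h8 := _root_.abs_le.mp (h.near ⟨p.symm j, hjn⟩)
        have h9 := _root_.abs_le.mp h6
        have h10 := _root_.abs_le.mp h2
        have h11 : |y i - y ⟨p.symm j, hjn⟩| < δ / 2 := by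
          rw [abs_lt]
          simp only at h8
          constructor <;> linarith [h8.1, h8.2, h9.1, h9.2, h10.1, h10.2]
        linarith
      simp only [Finset.coe_map, Set.mem_image, Finset.mem_coe]
      exact ⟨_, hjS, by simp⟩
    have h7 := Set.ncard_le_ncard hsub (Finset.finite_toSet _)
    rw [Set.ncard_coe_finset, Finset.card_map, hcard] at h7
    omega
  have h1 : S.card ≤ 1 := by
    rw [Finset.card_le_one]
    intro i hi j hj
    exact Fin.ext (p.injective ((hp0 i hi).trans (hp0 j hj).symm))
  omega

/-- For large `n`, the cluster is the only separated set of `d` eigenvalues. -/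
theorem eq_of_separatedBy_of_le (h : IsMatched d n lam δ x y p)
    (hΛ : ∀ i, i ∈ Λ ↔ p i ∈ Set.Icc 1 d) {B : Finset ℕ} (hB : ∀ j ∉ B, |lam j| < 0.01 * δ)
    (hn : B.card + 676 + d + 1 ≤ n) {S : Finset (Fin n)} (hcard : S.card = d)
    (hsep : SeparatedBy y S (δ / 2)) : S = Λ := by
  classical
  have hδ := h.pos
  have hd := h.three_le
  set Z : Finset (Fin n) := Finset.univ.filter fun i => |y i| ≤ 0.03 * δ with hZ
  set B₁ : Finset (Fin n) := Finset.univ.filter fun i => p i ∈ B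
  set B₂ : Finset (Fin n) := Finset.univ.filter fun i => 0.01 * δ ≤ |x i - lam (p i)|
  have hB₁ : B₁.card ≤ B.card := by
    rw [← Finset.card_map (Fin.valEmbedding.trans p.toEmbedding)]
    refine Finset.card_le_card fun j hj => ?_
    obtain ⟨i, hi, rfl⟩ := Finset.mem_map.mp hj
    exact (Finset.mem_filter.mp hi).2
  -- By Chebyshev, with `676 = (0.26 / 0.01)²`.
  have hB₂ : B₂.card ≤ 676 := by
    have h1 := card_mul_sq_le_of_sum_sq_le (η := 0.01 * δ) (by positivity) h.sum_le
      (B₂.map Fin.valEmbedding) (by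
        intro i hi
        obtain ⟨k, hk, rfl⟩ := Finset.mem_map.mp hi
        exact (Finset.mem_filter.mp hk).2)
    rw [Finset.card_map] at h1
    have h2 : ((B₂.card : ℝ) - 676) * δ ^ 2 ≤ 0 := by nlinarith
    have h3 : (B₂.card : ℝ) - 676 ≤ 0 := by
      by_contra hcon
      have := mul_pos (not_le.mp hcon) (pow_pos hδ 2)
      linarith
    have h4 : (B₂.card : ℝ) ≤ (676 : ℕ) := by push_cast; linarith
    exact_mod_cast h4
  -- Outside the exceptional sets, `|y i|` is at most `(0.01 + 0.01 + 1/128) δ < 0.03 δ`.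
  have hcover : (Finset.univ : Finset (Fin n)) ⊆ Z ∪ (B₁ ∪ B₂) := by
    intro i _
    simp only [Finset.mem_union]
    by_contra! hcon
    obtain ⟨h1, h2, h3⟩ := hcon
    simp only [Z, B₁, B₂, Finset.mem_filter, Finset.mem_univ, true_and, not_le] at h1 h2 h3
    have h4 := hB _ h2
    have h5 := h.near i
    have h6 := abs_sub_abs_le_abs_sub (y i) (x i)
    have h7 := abs_sub_abs_le_abs_sub (x i) (lam (p i))
    rw [abs_sub_comm (y i)] at h6
    linarith
  have hZcard : d < Z.card := by
    have h1 := Finset.card_le_card hcover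
    rw [Finset.card_univ, Fintype.card_fin] at h1
    have h2 := Finset.card_union_le Z (B₁ ∪ B₂)
    have h3 := Finset.card_union_le B₁ B₂
    omega
  -- Values in `Z` are within `0.06 δ` of each other, so `S` contains all of `Z` or none of it, and
  -- `Z` has more than `d` elements.
  have hdisj : ∀ z ∈ Z, z ∉ S := by
    intro z hz hzS
    have hsub : Z ⊆ S := by
      intro w hw
      by_contra hwS
      have h1 := hsep z hzS w hwS
      have h2 := abs_sub (y z) (y w)
      have h3 := (Finset.mem_filter.mp hz).2
      have h4 := (Finset.mem_filter.mp hw).2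
      linarith
    have := Finset.card_le_card hsub
    omega
  obtain ⟨z, hz⟩ : Z.Nonempty := Finset.card_pos.mp (by omega)
  refine h.eq_of_separatedBy hΛ hcard hsep fun i hi => ?_
  have h1 := hsep i hi z (hdisj z hz)
  have h2 := abs_sub (y i) (y z)
  have h3 := (Finset.mem_filter.mp hz).2
  linarith

/-- The largest eigenvalue is not in the cluster. -/
theorem val_ne_zero_of_mem (h : IsMatched d n lam δ x y p) (hy : Antitone y)
    (hΛ : ∀ i, i ∈ Λ ↔ p i ∈ Set.Icc 1 d) {i : Fin n} (hi : i ∈ Λ) : (i : ℕ) ≠ 0 := by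
  intro hi0
  have hδ := h.pos
  have hlam : lam 1 + δ ≤ lam 0 := by
    have h1 := h.gap 0 (by simp)
    have h2 := (le_abs_self (lam 1)).trans h.abs_le
    rw [abs_of_nonpos (by linarith)] at h1
    linarith
  -- The value matched with `lam 0 ≥ lam 1 + δ` exceeds every value of the cluster, so a member of
  -- the cluster cannot come first in the list.
  set j := p.symm 0 with hj
  have hpj : p j = 0 := by simp [hj]
  have h3 := _root_.abs_le.mp (h.abs_sub_lam_le j)
  rw [hpj] at h3
  have hjn : j < n := by
    by_contra hcon
    rw [h.zero _ (not_lt.mp hcon)] at h3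
    have := h.le_abs
    have := h.abs_le
    linarith [h3.1]
  have hij : (i : ℕ) ≠ j := by
    intro hij
    have h4 := (hΛ i).mp hi
    rw [hij, hpj] at h4
    exact absurd h4.1 (by norm_num)
  have h4 := h.abs_sub_lam_add_le hij
  rw [hpj, h.lam_eq _ ((hΛ i).mp hi)] at h4
  have h5 := _root_.abs_le.mp (h.near i)
  have h6 := _root_.abs_le.mp (h.near ⟨j, hjn⟩)
  simp only at h6
  have h7 : y ⟨j, hjn⟩ ≤ y i := hy (by rw [Fin.le_def, hi0]; exact Nat.zero_le _)
  have h8 := le_abs_self (x i - lam 1)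
  have h9 := neg_abs_le (x j - lam 0)
  linarith [h5.1, h5.2, h6.1, h6.2]

end IsMatched

/-! ### From the good event to the matching, and the proposition. -/

theorem probMatrix_isHermitian {d n : ℕ} (f : LinkFunction) (ρ : ℝ) (X : Fin n → Sph d) :
    (probMatrix f ρ X).IsHermitian := by
  ext i j
  simp [probMatrix, graphon_comm f (X i) (X j)]

/-- Since `2^{9/2} √d ≥ 22 · 1.7 ≥ 32`, the norm is at most `ρ δ² / 128`, and `δ ≤ 1`. -/
theorem opNorm_le_of_mem_goodEvent {d : ℕ} (hd : 3 ≤ d) {f : LinkFunction} {lam : ℕ → ℝ} {n : ℕ}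
    {ρ : ℝ} (hρ : 0 < ρ) {X : Fin n → Sph d} {That : Matrix (Fin n) (Fin n) ℝ}
    (hgap : 0 < spectralGap d lam) (hgap1 : spectralGap d lam ≤ 1)
    (h : (X, That) ∈ goodEvent d f lam n ρ) :
    opNorm (probMatrix f ρ X - That) ≤ ρ * (spectralGap d lam / 128) := by
  have h2 := h.2
  simp only at h2
  set δ := spectralGap d lam
  have hop : 0 ≤ opNorm (probMatrix f ρ X - That) := norm_nonneg _
  have hpow : (16 : ℝ) ≤ (2 : ℝ) ^ (9 / 2 : ℝ) := by
    calc (16 : ℝ) = (2 : ℝ) ^ (4 : ℝ) := by norm_num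
      _ ≤ (2 : ℝ) ^ (9 / 2 : ℝ) := Real.rpow_le_rpow_of_exponent_le (by norm_num) (by norm_num)
  have hpow2 : (22 : ℝ) ≤ (2 : ℝ) ^ (9 / 2 : ℝ) := by
    refine le_of_sq_le_sq ?_ (by linarith)
    rw [← Real.rpow_natCast, ← Real.rpow_natCast, ← Real.rpow_mul (by norm_num)]
    norm_num
  have hsqrt : (1.7 : ℝ) ≤ √d := by
    refine Real.le_sqrt_of_sq_le ?_
    have : (3 : ℝ) ≤ d := by exact_mod_cast hd
    linarith
  have hC : (32 : ℝ) ≤ (2 : ℝ) ^ (9 / 2 : ℝ) * √d := by nlinarith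
  rw [div_mul_eq_mul_div, div_le_iff₀ (by positivity)] at h2
  have h3 := mul_le_mul_of_nonneg_right hC hop
  nlinarith [mul_pos hρ hgap]

theorem proposition2p3 (d : ℕ) (hd : 3 ≤ d) (f : LinkFunction) (lam : ℕ → ℝ)
    (hlam : IsGraphonSpectrum d f lam) (hgap : 0 < spectralGap d lam) :
    ∃ n₀ : ℕ, ∀ (n : ℕ) (ρ : ℝ), 0 < ρ → ρ ≤ 1 →
      ∀ (X : Fin n → Sph d) (That : Matrix (Fin n) (Fin n) ℝ), IsNormalizedAdjacency That →
        (X, That) ∈ goodEvent d f lam n ρ →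
        ∃ Λ₁ : Finset (Fin n),
          Λ₁.card = d ∧
          DiamLt (sortedEig That) Λ₁ (ρ * spectralGap d lam / 2) ∧
          SeparatedBy (sortedEig That) Λ₁ (ρ * spectralGap d lam / 2) ∧
          (∀ i : Fin n, i ∈ Λ₁ ↔
            |1 / ρ * sortedEig (probMatrix f ρ X) i - lam 1| ≤ spectralGap d lam / 4) ∧
          (∀ i ∈ Λ₁, |1 / ρ * sortedEig That i - 1 / ρ * sortedEig (probMatrix f ρ X) i|
            ≤ spectralGap d lam / 8) ∧
          (∀ i ∈ Λ₁, ρ * spectralGap d lam / 2 ≤ |sortedEig That i|) ∧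
          (∀ S : Finset (Fin n), S.card = d →
            SeparatedBy (sortedEig That) S (ρ * spectralGap d lam / 2) →
            (∀ i ∈ S, ρ * spectralGap d lam / 2 ≤ |sortedEig That i|) → S = Λ₁) ∧
          (n₀ ≤ n →
            (∀ S : Finset (Fin n), S.card = d →
              SeparatedBy (sortedEig That) S (ρ * spectralGap d lam / 2) → S = Λ₁) ∧
            heicSet That d = Λ₁ ∧
            ∀ U : Matrix (Fin n) (Fin n) ℝ, IsEigenvectorMatrix That id U →
              ∀ V : Matrix (Fin n) {i // i ∈ Λ₁} ℝ,
                IsEigenvectorMatrix That (Subtype.val : {i // i ∈ Λ₁} → Fin n) V →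
                  heicGram That d U = gramOf d V) := by
  classical
  have hd0 : 0 < d := by omega
  have hgap1 : spectralGap d lam ≤ 1 :=
    (hlam.spectralGap_le_abs_lam_one.trans (hlam.abs_lam_one_le hd0)).trans
      (hlam.lam_zero_le_one hd0)
  obtain ⟨B, hB⟩ : ∃ B : Finset ℕ, ∀ j ∉ B, |lam j| < 0.01 * spectralGap d lam := by
    have h1 : ∀ᶠ j in cofinite, |lam j| < 0.01 * spectralGap d lam := by
      rw [Nat.cofinite_eq_atTop]
      have := hlam.tendsto_zero.abs
      rw [abs_zero] at this
      exact this.eventually_lt_const (by positivity)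
    rw [eventually_cofinite] at h1
    refine ⟨h1.toFinset, fun j hj => ?_⟩
    simpa using hj
  refine ⟨B.card + 676 + d + 1, fun n ρ hρ _ X That hThat hE => ?_⟩
  have hop := opNorm_le_of_mem_goodEvent hd hρ hgap hgap1 hE
  have hdelta := hE.1
  simp only at hdelta
  set δ := spectralGap d lam with hδ
  have hPH := probMatrix_isHermitian f ρ X
  have hTH : That.IsHermitian := by
    rw [Matrix.IsHermitian, Matrix.conjTranspose_eq_transpose_of_trivial]
    exact hThat.1
  set μ := sortedEig That with hμ
  set x : ℕ → ℝ := padZero (sortedEig ((1 / ρ) • probMatrix f ρ X)) with hx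
  set y : Fin n → ℝ := fun i => 1 / ρ * μ i with hy
  have hxi : ∀ i : Fin n, x i = 1 / ρ * sortedEig (probMatrix f ρ X) i := by
    intro i
    rw [hx, padZero, dif_pos i.2]
    exact sortedEig_smul hPH (by positivity) i
  have hμy : ∀ i, μ i = ρ * y i := fun i => by simp only [hy]; field_simp
  have hnear : ∀ i : Fin n, |x i - y i| ≤ δ / 128 := by
    intro i
    rw [hxi, ← mul_sub, abs_mul, abs_of_pos (by positivity), one_div, inv_mul_le_iff₀ hρ]
    exact (abs_sortedEig_sub_le hPH hTH i).trans hop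
  -- The permutation may depend on `r`; the cluster will not, and this recovers the exact threshold
  -- `δ/4`.
  have hmatch : ∀ r, δ / 4 < r → r ≤ 0.26 * δ → ∃ p, IsMatched d n lam δ x y p ∧
      ∀ i, |x i - lam (p i)| ≤ r := by
    intro r hr hr'
    have hr0 : 0 < r := by linarith
    obtain ⟨p, hp⟩ := exists_perm_of_delta2_le hdelta hr hr0
    exact ⟨p, ⟨hd, hgap, fun j hj => hlam.lam_eq_lam_one hj, fun j hj => hlam.spectralGap_le hj,
      hlam.spectralGap_le_abs_lam_one, hlam.abs_lam_one_le hd0,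
      fun k hk hne => hlam.eq_zero_or_lt_ncard hd hgap hk hne, hnear,
      fun i hi => by rw [hx, padZero, dif_neg (not_lt.mpr hi)],
      fun s => (hp s).trans (pow_le_pow_left₀ hr0.le hr' 2)⟩, abs_le_of_sum_sq_le hr0.le hp⟩
  obtain ⟨p, h, -⟩ := hmatch (0.26 * δ) (by linarith) le_rfl
  set Λ : Finset (Fin n) := Finset.univ.filter fun i => p i ∈ Set.Icc 1 d
  have hΛ : ∀ i, i ∈ Λ ↔ p i ∈ Set.Icc 1 d := fun i => by simp [Λ]
  have hΛ' : ∀ i, i ∈ Λ ↔ |x i - lam 1| ≤ δ / 4 := by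
    intro i
    rw [hΛ, ← h.abs_sub_lam_one_le_iff]
    constructor
    · intro hi
      refine le_of_forall_pos_le_add fun ε hε => ?_
      -- The criterion `|x i - lam 1| ≤ 0.26 δ` does not mention the permutation, so `i` lies in the
      -- cluster of every matching; let `r` decrease to `δ/4`.
      obtain ⟨p', h', hp'⟩ := hmatch (min (δ / 4 + ε) (0.26 * δ))
        (lt_min (by linarith) (by linarith)) (min_le_right _ _)
      have h1 := hp' i
      rw [h'.lam_eq _ ((h'.abs_sub_lam_one_le_iff i).mp hi)] at h1
      exact h1.trans (min_le_left _ _)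
    · intro hi
      linarith
  have hscale : ∀ i j, |μ i - μ j| = ρ * |y i - y j| := by
    intro i j
    rw [hμy, hμy, ← mul_sub, abs_mul, abs_of_pos hρ]
  have hscale0 : ∀ i, |μ i| = ρ * |y i| := by
    intro i
    rw [hμy, abs_mul, abs_of_pos hρ]
  have hsep_iff : ∀ S, SeparatedBy μ S (ρ * δ / 2) ↔ SeparatedBy y S (δ / 2) := by
    intro S
    simp only [SeparatedBy, hscale, mul_div_assoc, mul_le_mul_iff_right₀ hρ]
  have hdiam : DiamLt μ Λ (ρ * δ / 2) := by
    intro i hi j hj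
    rw [hscale, mul_div_assoc, mul_lt_mul_iff_right₀ hρ]
    exact h.diamLt hΛ i hi j hj
  have hsep : SeparatedBy μ Λ (ρ * δ / 2) := (hsep_iff Λ).mpr (h.separatedBy hΛ)
  have hanti : Antitone μ := sortedEig_antitone That
  have hyanti : Antitone y := fun i j hij =>
    mul_le_mul_of_nonneg_left (hanti hij) (by positivity)
  refine ⟨Λ, h.card_eq hΛ, hdiam, hsep, fun i => ?_, fun i _ => ?_, fun i hi => ?_,
    fun S hS hSsep hS0 => ?_, fun hn => ?_⟩
  · rw [hΛ', hxi]
  · have h1 := hnear i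
    rw [hxi, abs_sub_comm] at h1
    exact h1.trans (by linarith)
  · rw [hscale0, mul_div_assoc]
    exact mul_le_mul_of_nonneg_left (h.le_abs_of_mem hΛ hi) hρ.le
  · refine h.eq_of_separatedBy hΛ hS ((hsep_iff S).mp hSsep) fun i hi => ?_
    have h1 := hS0 i hi
    rw [hscale0, mul_div_assoc, mul_le_mul_iff_right₀ hρ] at h1
    linarith
  · have huniq : ∀ S : Finset (Fin n), S.card = d → SeparatedBy μ S (ρ * δ / 2) → S = Λ :=
      fun S hS hSsep => h.eq_of_separatedBy_of_le hΛ hB hn hS ((hsep_iff S).mp hSsep)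
    have hset : heicSet That d = Λ := window_heicLoop_eq hd0 (by omega) hanti (h.card_eq hΛ) hdiam
      hsep (fun i hi => h.val_ne_zero_of_mem hyanti hΛ hi) huniq
    refine ⟨huniq, hset, fun U hU V hV => ?_⟩
    have hne : ∀ i ∈ Λ, ∀ j ∉ Λ, sortedEig That i ≠ sortedEig That j := by
      intro i hi j hj heq
      have h1 := hsep i hi j hj
      rw [← hμ] at heq
      rw [heq, sub_self, abs_zero] at h1
      have : 0 < ρ * δ / 2 := by positivity
      linarith
    unfold heicGram
    rw [hset]
    unfold gramOf
    rw [eigenvectorMatrix_mul_transpose_eq hThat.1 hU hne hV]
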